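/- **Theorem 1.4.** For $\tau=u+iv$ in the upper half-plane $\mathbb H$ put $q:=e^{2\pi i\tau}$, and for integers $n\ge 0$ let $$U_{2n}(q):=\frac{\sum_{k\ge 0}(-1)^k(2k+1)^{2n+1}q^{k(k+1)/2}}{\sum_{k\ge 0}(-1)^k(2k+1)q^{k(k+1)/2}}=\frac{1^{2n+1}-3^{2n+1}q+5^{2n+1}q^3-\cdots}{1-3q+5q^3-\cdots},$$ $$V_{2n}(q):=\frac{\sum_{k\in\mathbb Z}(-1)^k(6k+1)^{2n}q^{k(3k+1)/2}}{\sum_{k\in\mathbb Z}(-1)^kq^{k(3k+1)/2}}=\frac{1^{2n}-5^{2n}q-7^{2n}q^2+11^{2n}q^5+\cdots}{1-q-q^2+q^5+\cdots}$$ be Ramanujan's $q$-series. Define $$\widehat U_{2n}(\tau):=2i\sum_{0\le j\le n}(-1)^{n+j}\frac{\pi^{2n-j+1}\,U_{2n-2j}(q)}{(2v)^j\,j!\,(2n-2j+1)!},\qquad \widehat V_{2n}(\tau):=\sum_{0\le j\le n}(-1)^{n+j}\frac{3^j\pi^{2n-j}\,V_{2n-2j}(q)}{(2v)^j\,j!\,(2n-2j)!}.$$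 An almost holomorphic modular form of weight $k$ and depth $p$ is a function $f:\mathbb H\to\mathbb C$ with $f\!\left(\frac{a\tau+b}{c\tau+d}\right)=(c\tau+d)^kf(\tau)$ for all $\left(\begin{smallmatrix}a&b\\c&d\end{smallmatrix}\right)\in\mathrm{SL}_2(\mathbb Z)$ that can be written as $f(\tau)=\sum_{j=0}^{p}f_j(\tau)v^{-j}$ with $f_0,\dots,f_p$ holomorphic on $\mathbb H$ and bounded as $v\to\infty$, and $f_p\not\equiv 0$. Its holomorphic part is $f_0$. Let $L:=-2iv^2\frac{\partial}{\partial\overline\tau}$ be the lowering operator. 1. For every $n\ge 0$ the functions $\widehat U_{2n}$ and $\widehat V_{2n}$ are almost holomorphic modular forms of weight $2n$ and depth (exactly) $n$. 2. We have $\widehat U_0=2\pi i$ and $\widehat V_0=1$; all $\widehat U_{2n}$ and $\widehat V_{2n}$ are real-differentiable in $(u,v)$, and for every $n\ge 1$ $$L\bigl(\widehat U_{2n}\bigr)=-\frac{\pi}{2}\,\widehat U_{2n-2},\qquad L\bigl(\widehat V_{2n}\bigr)=-\frac{3\pi}{2}\,\widehat V_{2n-2}.$$ 3. For every $n\ge 0$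 the holomorphic parts of $\widehat U_{2n}$ and $\widehat V_{2n}$ are $\dfrac{2(\pi i)^{2n+1}U_{2n}(q)}{(2n+1)!}$ and $\dfrac{(\pi i)^{2n}V_{2n}(q)}{(2n)!}$, respectively. Moreover, $$\lim_{\overline\tau\to-i\infty}\widehat U_{2n}(\tau)=\frac{2(\pi i)^{2n+1}U_{2n}(q)}{(2n+1)!},\qquad \lim_{\overline\tau\to-i\infty}\widehat V_{2n}(\tau)=\frac{(\pi i)^{2n}V_{2n}(q)}{(2n)!},$$ where $\tau$ and $\overline\tau$ are treated as independent variables: $\widehat U_{2n}(\tau)$ and $\widehat V_{2n}(\tau)$ are the restrictions to $w=\overline\tau$ of functions holomorphic in $(\tau,w)$ for $\operatorname{Im}\tau>0>\operatorname{Im}w$, and the limit is taken for fixed $\tau$ as $\operatorname{Im}w\to-\infty$. -/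

import Mathlib

open scoped Manifold MatrixGroups Topology

/-! ### Almost holomorphic modular forms for the full modular group -/

/-- `c 0, …, c p` are the coefficients of an expansion
`f τ = ∑_{j ≤ p} c j τ * (1 / v) ^ j` (with `v = Im τ`) of `f` as a polynomial in `1 / v`,
with coefficients holomorphic on the upper half-plane and at the cusp (that is, bounded
as `v → ∞`). -/
structure IsInvImExpansion (p : ℕ) (c : ℕ → UpperHalfPlane → ℂ) (f : UpperHalfPlane → ℂ) :
    Prop where
  holo : ∀ j ≤ p, MDifferentiable 𝓘(ℂ) 𝓘(ℂ) (c j)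
  bdd : ∀ j ≤ p, UpperHalfPlane.IsBoundedAtImInfty (c j)
  expand : ∀ τ : UpperHalfPlane,
    f τ = ∑ j ∈ Finset.range (p + 1), c j τ * (1 / (τ.im : ℂ)) ^ j

/-- `f` is an almost holomorphic modular form of weight `k` for `SL(2, ℤ)`, of depth exactly
`p`: it transforms like a modular form of weight `k`, and it is a polynomial of degree `p` in
`1 / v` with holomorphic coefficients (the leading one is not identically zero). -/
structure IsAlmostHolomorphicModularForm (k : ℤ) (p : ℕ) (f : UpperHalfPlane → ℂ) : Prop where
  transform : ∀ (γ : SL(2, ℤ)) (τ : UpperHalfPlane),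
    f (γ • τ) = (((γ 1 0 : ℤ) : ℂ) * (τ : ℂ) + ((γ 1 1 : ℤ) : ℂ)) ^ k * f τ
  expansion : ∃ c : ℕ → UpperHalfPlane → ℂ, IsInvImExpansion p c f ∧ ∃ τ, c p τ ≠ 0

/-- `g` is the holomorphic part of `f`: the constant coefficient of `f` as a polynomial in
`1 / v` with holomorphic coefficients. -/
def HasHolomorphicPart (f g : UpperHalfPlane → ℂ) : Prop :=
  ∃ (p : ℕ) (c : ℕ → UpperHalfPlane → ℂ), IsInvImExpansion p c f ∧ c 0 = g

/-- `F` is `f` with `τ` and `conj τ` treated as independent variables: a holomorphic function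
of `(τ, w)`, with `τ` in the upper and `w` in the lower half-plane, which equals `f τ` when
`w = conj τ`. (These values determine `F` on its domain.) -/
structure IsPolarization (f : UpperHalfPlane → ℂ) (F : ℂ → ℂ → ℂ) : Prop where
  holo : DifferentiableOn ℂ (fun x : ℂ × ℂ => F x.1 x.2) {x | 0 < x.1.im ∧ x.2.im < 0}
  diag : ∀ τ : UpperHalfPlane, F τ ((starRingEnd ℂ) (τ : ℂ)) = f τ

/-- The limit of `f τ` as `conj τ → -i∞`, with `τ` and `conj τ` treated as independent
variables, is `g τ`. -/
def HasConjLimit (f g : UpperHalfPlane → ℂ) : Prop :=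
  ∃ F : ℂ → ℂ → ℂ, IsPolarization f F ∧
    ∀ τ : UpperHalfPlane, Filter.Tendsto (F τ) (Filter.comap Complex.im Filter.atBot) (𝓝 (g τ))

/-! ### The lowering operator -/

/-- Real differentiability of a function on the upper half-plane. -/
def RealDifferentiable (f : UpperHalfPlane → ℂ) : Prop :=
  ∀ τ : UpperHalfPlane, DifferentiableAt ℝ (f ∘ UpperHalfPlane.ofComplex) (τ : ℂ)

/-- The Wirtinger derivative `∂f/∂(conj τ) = (∂f/∂u + i ∂f/∂v) / 2`, where `τ = u + i v`. -/
noncomputable def dConj (f : UpperHalfPlane → ℂ) (τ : UpperHalfPlane) : ℂ :=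
  (fderiv ℝ (f ∘ UpperHalfPlane.ofComplex) (τ : ℂ) 1
    + Complex.I * fderiv ℝ (f ∘ UpperHalfPlane.ofComplex) (τ : ℂ) Complex.I) / 2

/-- The lowering operator `L = -2 i v² ∂/∂(conj τ)`. -/
noncomputable def lowering (f : UpperHalfPlane → ℂ) (τ : UpperHalfPlane) : ℂ :=
  -2 * Complex.I * (τ.im : ℂ) ^ 2 * dConj f τ

/-! ### Ramanujan's `q`-series -/

/-- `1^m - 3^m q + 5^m q³ - 7^m q⁶ + 9^m q¹⁰ - ⋯`. -/
noncomputable def thetaU (m : ℕ) (q : ℂ) : ℂ :=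
  ∑' k : ℕ, (-1) ^ k * (2 * (k : ℂ) + 1) ^ m * q ^ (k * (k + 1) / 2)

/-- `1^m - 5^m q - 7^m q² + 11^m q⁵ + 13^m q⁷ - ⋯` for even `m`. The index `k ∈ ℤ` runs through
the terms in the order `k = 0, -1, 1, -2, 2, …`; the exponents are the generalized pentagonal
numbers `k (3 k + 1) / 2`, which are nonnegative integers. -/
noncomputable def thetaV (m : ℕ) (q : ℂ) : ℂ :=
  ∑' k : ℤ, (-1) ^ k.natAbs * (6 * (k : ℂ) + 1) ^ m * q ^ (k * (3 * k + 1) / 2).toNat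

theorem summable_linear_pow_mul_geometric (m : ℕ) (C : ℝ) {r : ℝ} (h0 : 0 ≤ r) (hr : r < 1) :
    Summable fun k : ℕ => (C * ((k : ℝ) + 1)) ^ m * r ^ k := by
  have h := summable_pow_mul_geometric_of_norm_lt_one (R := ℝ) m (r := r)
    (by rwa [Real.norm_of_nonneg h0])
  refine Summable.of_norm_bounded
    (g := fun k : ℕ => |C| ^ m * (2 ^ m * ((k : ℝ) ^ m * r ^ k) + r ^ k))
    (((h.mul_left _).add (summable_geometric_of_lt_one h0 hr)).mul_left _)
    fun k => ?_
  have hk : ((k : ℝ) + 1) ^ m ≤ 2 ^ m * (k : ℝ) ^ m + 1 := by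
    rcases Nat.eq_zero_or_pos k with rfl | hk
    · simp
    · have : (1 : ℝ) ≤ k := by exact_mod_cast hk
      calc ((k : ℝ) + 1) ^ m ≤ (2 * k) ^ m := by gcongr; linarith
        _ = 2 ^ m * (k : ℝ) ^ m := mul_pow ..
        _ ≤ _ := by linarith
  have h2 : 0 ≤ r ^ k := by positivity
  have h3 : |(k : ℝ) + 1| = k + 1 := abs_of_nonneg (by positivity)
  rw [norm_mul, norm_pow, Real.norm_eq_abs, abs_mul, h3, Real.norm_of_nonneg h2, mul_pow, mul_assoc]
  gcongr
  nlinarith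

/-- The series `thetaU m q` converges absolutely for `|q| < 1`. -/
theorem summable_thetaU (m : ℕ) {q : ℂ} (hq : ‖q‖ < 1) :
    Summable fun k : ℕ => (-1) ^ k * (2 * (k : ℂ) + 1) ^ m * q ^ (k * (k + 1) / 2) := by
  refine Summable.of_norm_bounded (summable_linear_pow_mul_geometric m 2 (norm_nonneg q) hq) fun k => ?_
  have h1 : ‖2 * (k : ℂ) + 1‖ ≤ 2 * ((k : ℝ) + 1) := by
    refine (norm_add_le _ _).trans ?_
    simp; linarith
  have h2 : k ≤ k * (k + 1) / 2 := by
    rw [Nat.le_div_iff_mul_le two_pos]; rcases k with _ | k <;> nlinarith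
  simp only [norm_mul, norm_pow, norm_neg, norm_one, one_pow, one_mul]
  gcongr ?_ ^ m * ?_
  exact pow_le_pow_of_le_one (norm_nonneg q) hq.le h2

/-- The series `thetaV m q` converges absolutely for `|q| < 1`. -/
theorem summable_thetaV (m : ℕ) {q : ℂ} (hq : ‖q‖ < 1) :
    Summable fun k : ℤ =>
      (-1) ^ k.natAbs * (6 * (k : ℂ) + 1) ^ m * q ^ (k * (3 * k + 1) / 2).toNat := by
  have hb : ∀ k : ℤ, ‖(-1) ^ k.natAbs * (6 * (k : ℂ) + 1) ^ m *
      q ^ (k * (3 * k + 1) / 2).toNat‖ ≤ (6 * ((k.natAbs : ℝ) + 1)) ^ m * ‖q‖ ^ k.natAbs := by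
    intro k
    have h1 : ‖6 * (k : ℂ) + 1‖ ≤ 6 * ((k.natAbs : ℝ) + 1) := by
      refine (norm_add_le _ _).trans ?_
      simp [Nat.cast_natAbs]
      linarith
    have h2 : k.natAbs ≤ (k * (3 * k + 1) / 2).toNat := by
      have : (k.natAbs : ℤ) ≤ k * (3 * k + 1) / 2 := by
        rw [Int.le_ediv_iff_mul_le two_pos]
        rcases le_total 0 k with h | h
        · rw [Int.natAbs_of_nonneg h]; rcases h.eq_or_lt with rfl | h <;> nlinarith
        · rw [Int.ofNat_natAbs_of_nonpos h]; rcases h.eq_or_lt with rfl | h <;> nlinarith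
      omega
    simp only [norm_mul, norm_pow, norm_neg, norm_one, one_pow, one_mul]
    gcongr ?_ ^ m * ?_
    exact pow_le_pow_of_le_one (norm_nonneg q) hq.le h2
  have hk := summable_linear_pow_mul_geometric m 6 (norm_nonneg q) hq
  refine Summable.of_norm_bounded (Summable.of_nat_of_neg ?_ ?_) hb <;> simpa using hk

/-- `ramanujanU n` is Ramanujan's series `U_{2n}(q)`. -/
noncomputable def ramanujanU (n : ℕ) (q : ℂ) : ℂ := thetaU (2 * n + 1) q / thetaU 1 q

/-- `ramanujanV n` is Ramanujan's series `V_{2n}(q)`. -/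
noncomputable def ramanujanV (n : ℕ) (q : ℂ) : ℂ := thetaV (2 * n) q / thetaV 0 q

/-- `q = e^{2πiτ}`. -/
noncomputable def nome (τ : UpperHalfPlane) : ℂ := Complex.exp (2 * Real.pi * Complex.I * (τ : ℂ))

/-- `completedU n` is the completion `Û_{2n}` of `U_{2n}`. -/
noncomputable def completedU (n : ℕ) (τ : UpperHalfPlane) : ℂ :=
  2 * Complex.I * ∑ j ∈ Finset.range (n + 1),
    (-1) ^ (n + j) * ((Real.pi : ℂ) ^ (2 * n - j + 1) * ramanujanU (n - j) (nome τ)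
      / ((2 * (τ.im : ℂ)) ^ j * (j.factorial : ℂ) * ((2 * n - 2 * j + 1).factorial : ℂ)))

/-- `completedV n` is the completion `V̂_{2n}` of `V_{2n}`. -/
noncomputable def completedV (n : ℕ) (τ : UpperHalfPlane) : ℂ :=
  ∑ j ∈ Finset.range (n + 1),
    (-1) ^ (n + j) * (3 ^ j * (Real.pi : ℂ) ^ (2 * n - j) * ramanujanV (n - j) (nome τ)
      / ((2 * (τ.im : ℂ)) ^ j * (j.factorial : ℂ) * ((2 * n - 2 * j).factorial : ℂ)))

/-! ### Power series -/

/-! The numerators of `U` and `V` are, up to constants, Taylor coefficients at `z = 0` of theta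
functions: of the odd function `jacobiU`, and of the even part in `z` of `jacobiV`. Under `τ ↦ -1 /
τ`, `z ↦ z / τ` each acquires an automorphy factor and `exp (2 κ i z² / τ)`, with `κ = π / 2` for
`U` and `κ = 3 π / 2` for `V`. Multiplication by `exp (κ z² / v)` absorbs this exponential
(`inv_im_S_smul`). Hence the coefficient of `(z²)^n` in the product, divided by a multiple of the
zeroth coefficient, has weight `2 n` (`sum_completion_transform`, `completion_S_smul`). These
quotients are the completed series (`completedU_eq_completion`, `completedV_eq_completion`).

Inversion sends `jacobiV` to a different theta function, but a computation modulo 3 identifies the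
even parts of the two up to `√3` (`jacobiVDual_add_neg`).

The coefficients are holomorphic because the denominators have no zeros in the disc: `q * thetaU 1 q
^ 8` and `q * thetaV 0 q ^ 24` are cusp forms of weight 12, hence nonzero multiples of the
discriminant (`ne_zero_of_weight_twelve`).

The remaining claims come from the factor `exp (κ w / v)`, where `w = z²`. The lowering operator
multiplies it by `-κ w`, which shifts the Taylor index by one; and `1 / v = 2 i / (τ - conj τ)`
tends to `0` as `conj τ → -i∞`. -/

theorem eq_zero_of_forall_hasSum_zero {d : ℕ → ℂ}
    (h : ∀ w : ℂ, w ≠ 0 → HasSum (fun n => d n * w ^ n) 0) : d = 0 := by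
  -- Shifting the coefficients by one, that is, multiplying by `w`, makes the sum at `w = 0` vanish
  -- trivially. The point is excluded in the hypothesis because the even function attached to
  -- `jacobiU` is formed by dividing by `z`.
  let e : ℕ → ℂ := fun n => Nat.casesOn n 0 d
  have he : ∀ w : ℂ, HasSum (fun n => w ^ n * e n) 0 := by
    intro w
    rw [hasSum_nat_add_iff' 1 |>.symm]
    by_cases hw : w = 0
    · simp [hw, e, hasSum_zero]
    · simpa [e, pow_succ, mul_comm, mul_left_comm, mul_assoc] using (h w hw).mul_left w
  have hp : HasFPowerSeriesAt (fun _ : ℂ => (0 : ℂ)) (FormalMultilinearSeries.ofScalars ℂ e) 0 := by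
    rw [hasFPowerSeriesAt_iff]
    refine Filter.Eventually.of_forall fun z => ?_
    simpa using he z
  have h0 := hp.eq_zero
  funext n
  exact congrFun ((FormalMultilinearSeries.ofScalars_series_eq_zero ℂ (c := e)).mp h0) (n + 1)

theorem HasSum.mul_pow_range {a b : ℕ → ℂ} {w s t : ℂ}
    (ha : HasSum (fun n => a n * w ^ n) s) (hb : HasSum (fun n => b n * w ^ n) t) :
    HasSum (fun n => (∑ j ∈ Finset.range (n + 1), a j * b (n - j)) * w ^ n) (s * t) := by
  have hs := summable_norm_sum_mul_range_of_summable_norm ha.summable.norm hb.summable.norm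
  have ht := tsum_mul_tsum_eq_tsum_sum_range_of_summable_norm
    ha.summable.norm hb.summable.norm
  rw [ha.tsum_eq, hb.tsum_eq] at ht
  rw [ht]
  have hc : ∀ n, ∑ j ∈ Finset.range (n + 1), a j * w ^ j * (b (n - j) * w ^ (n - j))
      = (∑ j ∈ Finset.range (n + 1), a j * b (n - j)) * w ^ n := by
    intro n
    rw [Finset.sum_mul]
    refine Finset.sum_congr rfl fun j hj => ?_
    rw [← pow_mul_pow_sub w (Nat.lt_succ_iff.mp (Finset.mem_range.mp hj))]
    ring
  simp only [hc] at hs ⊢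
  exact hs.of_norm.hasSum

theorem hasSum_exp_mul (c w : ℂ) :
    HasSum (fun n : ℕ => c ^ n / (n.factorial : ℂ) * w ^ n) (Complex.exp (c * w)) := by
  have := NormedSpace.expSeries_div_hasSum_exp (c * w)
  rw [← Complex.exp_eq_exp_ℂ] at this
  refine this.congr_fun fun n => ?_
  rw [mul_pow]; ring

/-- The transformation behaviour under `τ ↦ -1 / τ` of the Taylor coefficients of a Jacobi form,
after completion. -/
theorem sum_completion_transform {a b : ℕ → ℂ} {κ C c c' t : ℂ} (ht : t ≠ 0)
    (hc : c' / t ^ 2 + κ / t = c) {f g : ℂ → ℂ}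
    (ha : ∀ z ≠ 0, HasSum (fun n => a n * (z ^ 2) ^ n) (f z))
    (hb : ∀ z ≠ 0, HasSum (fun n => b n * (z ^ 2) ^ n) (g z))
    (hfg : ∀ z ≠ 0, g (z / t) = C * Complex.exp (κ / t * z ^ 2) * f z) (n : ℕ) :
    ∑ j ∈ Finset.range (n + 1), c' ^ j / (j.factorial : ℂ) * b (n - j)
      = C * t ^ (2 * n) * ∑ j ∈ Finset.range (n + 1), c ^ j / (j.factorial : ℂ) * a (n - j) := by
  set B : ℕ → ℂ := fun n => ∑ j ∈ Finset.range (n + 1), c' ^ j / (j.factorial : ℂ) * b (n - j)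
  set A : ℕ → ℂ := fun n => ∑ j ∈ Finset.range (n + 1), c ^ j / (j.factorial : ℂ) * a (n - j)
  -- Both sides are Cauchy products, of `exp (c' (z / t)²) g (z / t)` and `C exp (c z²) f z`. These
  -- agree by `hc` and `hfg`, so their coefficients in `w = z²` are compared.
  have key : (fun n => B n / t ^ (2 * n) - C * A n) = 0 := by
    refine eq_zero_of_forall_hasSum_zero fun w hw => ?_
    obtain ⟨z, rfl⟩ := IsAlgClosed.exists_pow_nat_eq w two_pos
    have hz : z ≠ 0 := ne_zero_pow two_ne_zero hw
    have h1 := (hasSum_exp_mul c' ((z / t) ^ 2)).mul_pow_range (hb _ (div_ne_zero hz ht))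
    have h2 := ((hasSum_exp_mul c (z ^ 2)).mul_pow_range (ha _ hz)).mul_left C
    have h3 := h1.sub h2
    have h4 : Complex.exp (c' * (z / t) ^ 2) * g (z / t)
        - C * (Complex.exp (c * z ^ 2) * f z) = 0 := by
      have : Complex.exp (c * z ^ 2)
          = Complex.exp (c' * (z / t) ^ 2) * Complex.exp (κ / t * z ^ 2) := by
        rw [← Complex.exp_add, ← hc, div_pow]; congr 1; ring
      rw [hfg z hz, this]; ring
    rw [h4] at h3
    refine h3.congr_fun fun n => ?_
    change (B n / t ^ (2 * n) - C * A n) * (z ^ 2) ^ n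
      = B n * ((z / t) ^ 2) ^ n - C * (A n * (z ^ 2) ^ n)
    rw [div_pow, div_pow (z ^ 2), ← pow_mul t]
    ring
  have := congrFun key n
  simp only [Pi.zero_apply, sub_eq_zero] at this
  rw [div_eq_iff (pow_ne_zero _ ht)] at this
  change B n = C * t ^ (2 * n) * A n
  rw [this]; ring

/-! ### The nome -/

theorem norm_nome_lt_one (τ : UpperHalfPlane) : ‖nome τ‖ < 1 := by
  have := τ.im_pos
  rw [nome, Complex.norm_exp, Real.exp_lt_one_iff]
  have : (2 * Real.pi * Complex.I * (τ : ℂ)).re = -(2 * Real.pi * τ.im) := by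
    simp [Complex.mul_re, Complex.mul_im]
  rw [this, neg_lt_zero]
  positivity

theorem nome_mem_ball (τ : UpperHalfPlane) : nome τ ∈ Metric.ball (0 : ℂ) 1 := by
  simpa using norm_nome_lt_one τ

theorem nome_eq_qParam (τ : UpperHalfPlane) : nome τ = Function.Periodic.qParam 1 τ := by
  simp [nome, Function.Periodic.qParam]

theorem exists_nome_eq {q : ℂ} (hq : ‖q‖ < 1) (hq0 : q ≠ 0) : ∃ τ, nome τ = q :=
  ⟨⟨_, Function.Periodic.im_invQParam_pos_of_norm_lt_one one_pos hq hq0⟩, by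
    rw [nome_eq_qParam]
    exact Function.Periodic.qParam_right_inv one_ne_zero hq0⟩

theorem tendsto_nome_atImInfty :
    Filter.Tendsto nome UpperHalfPlane.atImInfty (𝓝 0) := by
  simpa only [← nome_eq_qParam] using UpperHalfPlane.qParam_tendsto_atImInfty one_pos

theorem nome_T_smul (τ : UpperHalfPlane) : nome (ModularGroup.T • τ) = nome τ := by
  rw [UpperHalfPlane.modular_T_smul, nome, nome, UpperHalfPlane.coe_vadd,
    Complex.exp_eq_exp_iff_exists_int]
  exact ⟨1, by push_cast; ring⟩

theorem exp_mem_ball {z : ℂ} (hz : 0 < z.im) :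
    Complex.exp (2 * Real.pi * Complex.I * z) ∈ Metric.ball (0 : ℂ) 1 :=
  nome_mem_ball ⟨z, hz⟩

theorem differentiableOn_comp_exp {ρ : ℂ → ℂ} (hρ : DifferentiableOn ℂ ρ (Metric.ball 0 1)) :
    DifferentiableOn ℂ (fun z => ρ (Complex.exp (2 * Real.pi * Complex.I * z))) {z | 0 < z.im} :=
  hρ.comp (by fun_prop) fun _ hz => exp_mem_ball hz

theorem mdifferentiable_comp_nome {ρ : ℂ → ℂ} (hρ : DifferentiableOn ℂ ρ (Metric.ball 0 1)) :
    MDifferentiable 𝓘(ℂ) 𝓘(ℂ) fun τ => ρ (nome τ) := by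
  rw [UpperHalfPlane.mdifferentiable_iff]
  refine (differentiableOn_comp_exp hρ).congr fun z hz => ?_
  simp [nome, UpperHalfPlane.ofComplex_apply_of_im_pos hz]

theorem tendsto_comp_nome {ρ : ℂ → ℂ} (hρ : DifferentiableOn ℂ ρ (Metric.ball 0 1)) :
    Filter.Tendsto (fun τ => ρ (nome τ)) UpperHalfPlane.atImInfty (𝓝 (ρ 0)) :=
  ((hρ.continuousOn.continuousAt (Metric.ball_mem_nhds 0 one_pos)).tendsto).comp
    tendsto_nome_atImInfty

theorem isBoundedAtImInfty_comp_nome {ρ : ℂ → ℂ}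
    (hρ : DifferentiableOn ℂ ρ (Metric.ball 0 1)) :
    UpperHalfPlane.IsBoundedAtImInfty fun τ => ρ (nome τ) :=
  (tendsto_comp_nome hρ).isBigO_one ℝ

/-! ### Ramanujan's numerators and denominators as functions of `q` -/

theorem differentiableOn_thetaU (m : ℕ) : DifferentiableOn ℂ (thetaU m) (Metric.ball 0 1) := by
  intro q hq
  obtain ⟨r, hqr, hr⟩ := exists_between (mem_ball_zero_iff.mp hq)
  have hr0 : 0 ≤ r := (norm_nonneg q).trans hqr.le
  have hs := (summable_thetaU m (q := (r : ℂ)) (by simpa [abs_of_nonneg hr0] using hr)).norm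
  refine (Complex.differentiableOn_tsum_of_summable_norm (U := Metric.ball 0 r) hs
    (fun k => by fun_prop) Metric.isOpen_ball fun k w hw => ?_).differentiableAt
    (Metric.isOpen_ball.mem_nhds (by simpa using hqr)) |>.differentiableWithinAt
  rw [norm_mul, norm_mul _ ((r : ℂ) ^ _), norm_pow w, norm_pow (r : ℂ), Complex.norm_real,
    Real.norm_of_nonneg hr0]
  gcongr
  exact (mem_ball_zero_iff.mp hw).le

theorem differentiableOn_thetaV (m : ℕ) : DifferentiableOn ℂ (thetaV m) (Metric.ball 0 1) := by
  intro q hq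
  obtain ⟨r, hqr, hr⟩ := exists_between (mem_ball_zero_iff.mp hq)
  have hr0 : 0 ≤ r := (norm_nonneg q).trans hqr.le
  have hs := (summable_thetaV m (q := (r : ℂ)) (by simpa [abs_of_nonneg hr0] using hr)).norm
  refine (Complex.differentiableOn_tsum_of_summable_norm (U := Metric.ball 0 r) hs
    (fun k => by fun_prop) Metric.isOpen_ball fun k w hw => ?_).differentiableAt
    (Metric.isOpen_ball.mem_nhds (by simpa using hqr)) |>.differentiableWithinAt
  rw [norm_mul, norm_mul _ ((r : ℂ) ^ _), norm_pow w, norm_pow (r : ℂ), Complex.norm_real,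
    Real.norm_of_nonneg hr0]
  gcongr
  exact (mem_ball_zero_iff.mp hw).le

theorem thetaU_zero_right (m : ℕ) : thetaU m 0 = 1 := by
  rw [thetaU, tsum_eq_single 0]
  · simp
  · intro k hk
    have : 1 ≤ k * (k + 1) / 2 := by
      rw [Nat.le_div_iff_mul_le two_pos]
      have : 1 ≤ k := Nat.one_le_iff_ne_zero.mpr hk
      nlinarith
    rw [zero_pow (by omega), mul_zero]

theorem thetaV_zero_right (m : ℕ) : thetaV m 0 = 1 := by
  rw [thetaV, tsum_eq_single 0]
  · simp
  · intro k hk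
    have : 1 ≤ k * (3 * k + 1) / 2 := by
      rw [Int.le_ediv_iff_mul_le two_pos]
      rcases lt_or_gt_of_ne hk with h | h <;> nlinarith
    rw [zero_pow (by omega), mul_zero]

/-! ### Weight twelve -/

/-- `S` and `T` generate the modular group. -/
theorem slash_eq_of_S_of_T {f : UpperHalfPlane → ℂ} {k : ℤ}
    (hS : ∀ τ : UpperHalfPlane, f (ModularGroup.S • τ) = (τ : ℂ) ^ k * f τ)
    (hT : ∀ τ : UpperHalfPlane, f (ModularGroup.T • τ) = f τ) (γ : SL(2, ℤ)) :
    SlashAction.map k γ f = f := by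
  refine SlashInvariantForm.slash_action_generators_SL2Z ?_ ?_ γ
  · ext z
    rw [ModularForm.SL_slash_apply, hS, ModularGroup.denom_S, mul_comm, ← mul_assoc,
      ← zpow_add₀ z.ne_zero, neg_add_cancel, zpow_zero, one_mul]
  · ext z
    have hd : UpperHalfPlane.denom ModularGroup.T z = 1 := by
      rw [ModularGroup.denom_apply]; simp [ModularGroup.T]
    rw [ModularForm.SL_slash_apply, hT, hd, one_zpow, mul_one]

/-- A function on the unit disc such that `q * g q` is a nonzero cusp form of weight `12` has no
zeros away from the cusp: it is a multiple of the discriminant. -/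
theorem ne_zero_of_weight_twelve {g : ℂ → ℂ} (hg : DifferentiableOn ℂ g (Metric.ball 0 1))
    (hg0 : g 0 ≠ 0)
    (hS : ∀ τ : UpperHalfPlane, nome (ModularGroup.S • τ) * g (nome (ModularGroup.S • τ))
      = (τ : ℂ) ^ 12 * (nome τ * g (nome τ))) (τ : UpperHalfPlane) :
    g (nome τ) ≠ 0 := by
  set f : UpperHalfPlane → ℂ := fun τ => nome τ * g (nome τ) with hf
  have hd : DifferentiableOn ℂ (fun q => q * g q) (Metric.ball 0 1) := differentiableOn_id.mul hg
  have hinv := slash_eq_of_S_of_T (f := f) (k := 12) hS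
    fun τ => by simp only [hf, nome_T_smul]
  have hz : UpperHalfPlane.IsZeroAtImInfty f := by
    have := tendsto_comp_nome hd
    simpa [UpperHalfPlane.IsZeroAtImInfty, Filter.ZeroAtFilter, hf] using this
  let F : CuspForm (Matrix.SpecialLinearGroup.mapGL ℝ : SL(2, ℤ) →* _).range 12 :=
    { toFun := f
      slash_action_eq' := by
        rintro _ ⟨γ, rfl⟩
        exact hinv γ
      holo' := mdifferentiable_comp_nome hd
      zero_at_cusps' := by
        intro c hc
        rw [Subgroup.IsArithmetic.isCusp_iff_isCusp_SL2Z] at hc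
        rw [OnePoint.isZeroAt_iff_forall_SL2Z hc]
        intro γ _
        rw [hinv]
        exact hz }
  obtain ⟨c, hc⟩ := CuspForm.exists_smul_discriminant_of_weight_eq_twelve F
  have hcf : ∀ τ, c * ModularForm.discriminant τ = f τ := fun τ => DFunLike.congr_fun hc τ
  -- If `c = 0`, then `q * g q` vanishes on the whole punctured disc, against `g 0 ≠ 0` and
  -- continuity at the cusp.
  have hc0 : c ≠ 0 := by
    rintro rfl
    have hev := (tendsto_comp_nome hg).eventually_ne hg0
    obtain ⟨σ, hσ⟩ := hev.exists
    have := hcf σ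
    simp only [zero_mul, hf] at this
    exact hσ ((mul_eq_zero.mp this.symm).resolve_left (Complex.exp_ne_zero _))
  intro h0
  have := hcf τ
  simp only [hf, h0, mul_zero] at this
  exact (mul_ne_zero hc0 (ModularForm.discriminant_ne_zero τ)) this

theorem ne_zero_on_ball_of_weight_twelve {g : ℂ → ℂ}
    (hg : DifferentiableOn ℂ g (Metric.ball 0 1)) (hg0 : g 0 ≠ 0)
    (hS : ∀ τ : UpperHalfPlane, nome (ModularGroup.S • τ) * g (nome (ModularGroup.S • τ))
      = (τ : ℂ) ^ 12 * (nome τ * g (nome τ))) {q : ℂ} (hq : q ∈ Metric.ball (0 : ℂ) 1) :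
    g q ≠ 0 := by
  rcases eq_or_ne q 0 with rfl | h
  · exact hg0
  · obtain ⟨τ, rfl⟩ := exists_nome_eq (mem_ball_zero_iff.mp hq) h
    exact ne_zero_of_weight_twelve hg hg0 hS τ

/-! ### Completions of Taylor coefficients -/

/-- The coefficient of `w ^ n` in `exp (κ w / v) * ∑ m, ρ m (q) w ^ m`, where `v = Im τ`. -/
noncomputable def completion (κ : ℂ) (ρ : ℕ → ℂ → ℂ) (n : ℕ) (τ : UpperHalfPlane) : ℂ :=
  ∑ j ∈ Finset.range (n + 1), (κ / (τ.im : ℂ)) ^ j / (j.factorial : ℂ) * ρ (n - j) (nome τ)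

section completion

variable {κ : ℂ} {ρ : ℕ → ℂ → ℂ}

theorem isInvImExpansion_completion (hρ : ∀ m, DifferentiableOn ℂ (ρ m) (Metric.ball 0 1)) (n : ℕ) :
    IsInvImExpansion n (fun j τ => κ ^ j / (j.factorial : ℂ) * ρ (n - j) (nome τ))
      (completion κ ρ n) where
  holo j _ := mdifferentiable_comp_nome ((hρ (n - j)).const_mul _)
  bdd j _ := isBoundedAtImInfty_comp_nome ((hρ (n - j)).const_mul _)
  expand τ := by
    refine Finset.sum_congr rfl fun j _ => ?_
    rw [div_pow, div_pow, one_pow]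
    ring

theorem hasHolomorphicPart_completion (hρ : ∀ m, DifferentiableOn ℂ (ρ m) (Metric.ball 0 1))
    (n : ℕ) : HasHolomorphicPart (completion κ ρ n) fun τ => ρ n (nome τ) :=
  ⟨n, _, isInvImExpansion_completion hρ n, by simp⟩

theorem isAlmostHolomorphicModularForm_completion (hκ : κ ≠ 0)
    (hρ : ∀ m, DifferentiableOn ℂ (ρ m) (Metric.ball 0 1)) (hρ0 : ∃ τ, ρ 0 (nome τ) ≠ 0)
    (n : ℕ) (hS : ∀ τ : UpperHalfPlane,
      completion κ ρ n (ModularGroup.S • τ) = (τ : ℂ) ^ (2 * n) * completion κ ρ n τ) :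
    IsAlmostHolomorphicModularForm (2 * (n : ℤ)) n (completion κ ρ n) where
  transform γ τ := by
    have hinv := slash_eq_of_S_of_T (f := completion κ ρ n) (k := 2 * (n : ℤ))
      (fun τ => by rw [hS]; norm_cast)
      (fun τ => by
        have him : (ModularGroup.T • τ).im = τ.im := by rw [UpperHalfPlane.modular_T_smul]; simp
        simp only [completion, nome_T_smul, him]) γ
    have h := congrFun hinv τ
    rw [ModularForm.SL_slash_apply, zpow_neg, ← div_eq_mul_inv,
      div_eq_iff (zpow_ne_zero _ (UpperHalfPlane.denom_ne_zero _ _))] at h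
    rw [h, mul_comm]
    simp [UpperHalfPlane.denom]
  expansion := by
    refine ⟨_, isInvImExpansion_completion hρ n, ?_⟩
    obtain ⟨τ, hτ⟩ := hρ0
    -- The coefficient of `v⁻ⁿ` is `κ ^ n / n!` times `ρ 0`, so the depth is exactly `n`.
    refine ⟨τ, mul_ne_zero (div_ne_zero (pow_ne_zero _ hκ) ?_) (by simpa using hτ)⟩
    exact_mod_cast n.factorial_ne_zero

/-- Replacing `1 / v` by `2 i / (z - w)` polarizes the sum. Since `|z - w| ≥ -Im w` there, only the
term `j = 0` survives in the limit. -/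
theorem hasConjLimit_completion (hρ : ∀ m, DifferentiableOn ℂ (ρ m) (Metric.ball 0 1))
    (n : ℕ) : HasConjLimit (completion κ ρ n) fun τ => ρ n (nome τ) := by
  refine ⟨fun z w => ∑ j ∈ Finset.range (n + 1), (κ * (2 * Complex.I / (z - w))) ^ j /
    (j.factorial : ℂ) * ρ (n - j) (Complex.exp (2 * Real.pi * Complex.I * z)), ⟨?_, ?_⟩, ?_⟩
  · refine DifferentiableOn.fun_sum fun j _ => ?_
    have h1 : DifferentiableOn ℂ
        (fun x : ℂ × ℂ => ρ (n - j) (Complex.exp (2 * Real.pi * Complex.I * x.1)))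
        {x | 0 < x.1.im ∧ x.2.im < 0} :=
      (differentiableOn_comp_exp (hρ (n - j))).comp differentiableOn_fst fun x hx => hx.1
    have h2 : DifferentiableOn ℂ (fun x : ℂ × ℂ => 2 * Complex.I / (x.1 - x.2))
        {x | 0 < x.1.im ∧ x.2.im < 0} := by
      have hi : DifferentiableOn ℂ (fun y : ℂ => 2 * Complex.I / y) {0}ᶜ :=
        (differentiableOn_const _).div differentiableOn_id fun y hy => hy
      refine hi.comp (differentiableOn_fst.sub differentiableOn_snd) fun x hx h => ?_
      have := congrArg Complex.im (Set.mem_singleton_iff.mp h)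
      simp only [Complex.sub_im, Complex.zero_im] at this
      linarith [hx.1, hx.2]
    have h3 : DifferentiableOn ℂ
        (fun x : ℂ × ℂ => (κ * (2 * Complex.I / (x.1 - x.2))) ^ j / (j.factorial : ℂ))
        {x | 0 < x.1.im ∧ x.2.im < 0} := by
      simpa only [div_eq_mul_inv _ (j.factorial : ℂ)] using
        ((h2.const_mul κ).fun_pow j).mul_const (j.factorial : ℂ)⁻¹
    exact h3.mul h1
  · intro τ
    have hv : (τ.im : ℂ) ≠ 0 := by exact_mod_cast τ.im_ne_zero
    have h : (τ : ℂ) - (starRingEnd ℂ) (τ : ℂ) = 2 * Complex.I * τ.im := by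
      rw [Complex.sub_conj]; push_cast; simp; ring
    simp only [h]
    refine Finset.sum_congr rfl fun j _ => ?_
    rw [show κ * (2 * Complex.I / (2 * Complex.I * τ.im)) = κ / τ.im by
      have := Complex.I_ne_zero
      field_simp]
    rfl
  · intro τ
    have h0 : Filter.Tendsto (fun w : ℂ => κ * (2 * Complex.I / ((τ : ℂ) - w)))
        (Filter.comap Complex.im Filter.atBot) (𝓝 0) := by
      rw [← mul_zero κ]
      refine Filter.Tendsto.const_mul _ ?_
      rw [tendsto_zero_iff_norm_tendsto_zero]
      have h1 : Filter.Tendsto (fun w : ℂ => ‖(τ : ℂ) - w‖)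
          (Filter.comap Complex.im Filter.atBot) Filter.atTop := by
        refine Filter.tendsto_atTop_mono (f := fun w : ℂ => -w.im) (fun w => ?_)
          (Filter.tendsto_neg_atBot_atTop.comp Filter.tendsto_comap)
        refine le_trans ?_ (Complex.im_le_norm _)
        have := τ.im_pos
        simp only [Complex.sub_im, UpperHalfPlane.coe_im]
        linarith
      simpa only [norm_div] using h1.const_div_atTop ‖2 * Complex.I‖
    have h1 : ρ n (nome τ) = ∑ j ∈ Finset.range (n + 1), (0 : ℂ) ^ j / (j.factorial : ℂ) *
        ρ (n - j) (Complex.exp (2 * Real.pi * Complex.I * τ)) := by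
      rw [Finset.sum_range_succ', Finset.sum_eq_zero]
      · simp [nome]
      · intro j _
        simp
    simp only [h1]
    exact tendsto_finsetSum _ fun j _ => ((h0.pow j).div_const _).mul_const _

theorem hasFDerivAt_inv_im {z : ℂ} (hz : z.im ≠ 0) (c : ℂ) (j : ℕ) :
    HasFDerivAt (fun w : ℂ => (c / (w.im : ℂ)) ^ j)
      ((-(j * c ^ j / (z.im : ℂ) ^ (j + 1))) • (Complex.ofRealCLM.comp Complex.imCLM)) z := by
  have hz' : (z.im : ℂ) ≠ 0 := by exact_mod_cast hz
  have h1 : HasDerivAt (fun x : ℂ => (c / x) ^ j)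
      (-(j * c ^ j / (z.im : ℂ) ^ (j + 1))) (z.im : ℂ) := by
    have := ((hasDerivAt_inv hz').const_mul c).fun_pow j
    simp only [← div_eq_mul_inv] at this
    refine this.congr_deriv ?_
    rcases j with _ | j
    · simp
    · rw [Nat.add_sub_cancel, div_pow]
      field_simp
      ring
  have h2 := (Complex.ofRealCLM.comp Complex.imCLM).hasFDerivAt (x := z)
  refine ((h1.hasFDerivAt.restrictScalars ℝ).comp z h2).congr_fderiv ?_
  ext x
  simp [mul_comm]

/-- The derivative splits into a `ℂ`-linear part and a multiple of `Im`. The scalars `d j` may stay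
unspecified because the Wirtinger derivative annihilates the first part. -/
theorem hasFDerivAt_completion (hρ : ∀ m, DifferentiableOn ℂ (ρ m) (Metric.ball 0 1)) (n : ℕ)
    (τ : UpperHalfPlane) : ∃ d : ℕ → ℂ, HasFDerivAt (completion κ ρ n ∘ UpperHalfPlane.ofComplex)
      (∑ j ∈ Finset.range (n + 1), (((κ / (τ.im : ℂ)) ^ j / (j.factorial : ℂ)) •
          (d j • (1 : ℂ →L[ℝ] ℂ)) +
        ρ (n - j) (nome τ) • ((1 / (j.factorial : ℂ)) •
          ((-(j * κ ^ j / (τ.im : ℂ) ^ (j + 1))) • (Complex.ofRealCLM.comp Complex.imCLM)))))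
      (τ : ℂ) := by
  have hd : ∀ j, ∃ d : ℂ, HasDerivAt
      (fun z => ρ (n - j) (Complex.exp (2 * Real.pi * Complex.I * z))) d (τ : ℂ) := fun j =>
    ⟨_, ((differentiableOn_comp_exp (hρ (n - j))).differentiableAt
      (UpperHalfPlane.isOpen_upperHalfPlaneSet.mem_nhds τ.im_pos)).hasDerivAt⟩
  choose d hd using hd
  refine ⟨d, ?_⟩
  have hsum := HasFDerivAt.fun_sum (u := Finset.range (n + 1)) fun j _ =>
    (((hasFDerivAt_inv_im (z := (τ : ℂ)) τ.im_ne_zero κ j).const_mul (1 / (j.factorial : ℂ))).mul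
      ((hd j).hasFDerivAt.restrictScalars ℝ))
  refine (hsum.congr_of_eventuallyEq ?_).congr_fderiv ?_
  · filter_upwards [UpperHalfPlane.isOpen_upperHalfPlaneSet.mem_nhds τ.im_pos] with z hz
    simp only [Function.comp_apply, completion, UpperHalfPlane.ofComplex_apply_of_im_pos hz]
    refine Finset.sum_congr rfl fun j _ => ?_
    simp only [nome, UpperHalfPlane.im, Pi.mul_apply]
    ring
  · refine Finset.sum_congr rfl fun j _ => ?_
    congr 1
    ext x
    simp [div_eq_mul_inv]
    ring

theorem realDifferentiable_completion (hρ : ∀ m, DifferentiableOn ℂ (ρ m) (Metric.ball 0 1))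
    (n : ℕ) : RealDifferentiable (completion κ ρ n) := fun τ =>
  let ⟨_, h⟩ := hasFDerivAt_completion hρ n τ
  h.differentiableAt

/-- Since `∂v/∂(conj τ) = i / 2`, the lowering operator sends `(κ / v) ^ j / j!` to `-κ (κ / v) ^ (j
- 1) / (j - 1)!` for `j ≥ 1` and kills the term `j = 0`. -/
theorem lowering_completion (hρ : ∀ m, DifferentiableOn ℂ (ρ m) (Metric.ball 0 1))
    (n : ℕ) (τ : UpperHalfPlane) :
    lowering (completion κ ρ (n + 1)) τ = -κ * completion κ ρ n τ := by
  obtain ⟨d, h⟩ := hasFDerivAt_completion (κ := κ) hρ (n + 1) τ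
  have hv : (τ.im : ℂ) ≠ 0 := by exact_mod_cast τ.im_ne_zero
  rw [lowering, dConj, h.fderiv]
  set A := fun j : ℕ => ((κ / (τ.im : ℂ)) ^ j / (j.factorial : ℂ)) • (d j • (1 : ℂ →L[ℝ] ℂ)) +
    ρ (n + 1 - j) (nome τ) • ((1 / (j.factorial : ℂ)) •
      ((-(j * κ ^ j / (τ.im : ℂ) ^ (j + 1))) • (Complex.ofRealCLM.comp Complex.imCLM))) with hA
  have hsum : ∀ x, (∑ j ∈ Finset.range (n + 1 + 1), A j) x = ∑ j ∈ Finset.range (n + 1 + 1), A j x :=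
    fun x => by simp
  rw [hsum, hsum, Finset.mul_sum, ← Finset.sum_add_distrib, Finset.sum_div, Finset.mul_sum,
    Finset.sum_range_succ', completion, Finset.mul_sum]
  have hterm : ∀ j, -2 * Complex.I * (τ.im : ℂ) ^ 2 * ((A j 1 + Complex.I * A j Complex.I) / 2)
      = -(j * κ ^ j / (τ.im : ℂ) ^ (j + 1)) * (τ.im : ℂ) ^ 2 / (j.factorial : ℂ)
        * ρ (n + 1 - j) (nome τ) := by
    intro j
    simp only [hA, add_apply, smul_apply, smul_eq_mul,
      one_apply_eq_self, ContinuousLinearMap.comp_apply, Complex.imCLM_apply,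
      Complex.ofRealCLM_apply, Complex.one_im, Complex.I_im, Complex.ofReal_one,
      Complex.ofReal_zero]
    linear_combination ((τ.im : ℂ) ^ 2 * (j * κ ^ j / (τ.im : ℂ) ^ (j + 1)) / (j.factorial : ℂ)
        * ρ (n + 1 - j) (nome τ) - (τ.im : ℂ) ^ 2 * ((κ / (τ.im : ℂ)) ^ j / (j.factorial : ℂ))
        * d j * Complex.I) * Complex.I_mul_I
  simp only [hterm]
  rw [Nat.cast_zero, zero_mul, zero_div, neg_zero, zero_mul, zero_div, zero_mul, add_zero]
  refine Finset.sum_congr rfl fun j _ => ?_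
  rw [Nat.add_sub_add_right, Nat.factorial_succ, div_pow]
  have hj : (j.factorial : ℂ) ≠ 0 := by exact_mod_cast j.factorial_ne_zero
  have hj1 : ((j : ℂ) + 1) ≠ 0 := by exact_mod_cast j.succ_ne_zero
  push_cast
  field_simp
  ring

end completion

/-! ### Two-variable theta functions -/

/-- Summing a family of entire power series in `x k * z`, weighted by `c k`. -/
theorem hasSum_tsum_comm {ι : Type*} {c x : ι → ℂ} {z : ℂ} {e : ℕ → ℕ} {F : ℂ → ℂ}
    {G : ℝ → ℝ} (hF : ∀ y : ℂ, HasSum (fun n => y ^ e n / ((e n).factorial : ℂ)) (F y))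
    (hG : ∀ y : ℝ, HasSum (fun n => y ^ e n / ((e n).factorial : ℝ)) (G y))
    (hs : Summable fun k => ‖c k‖ * G ‖x k * z‖) :
    HasSum (fun n => (∑' k, c k * x k ^ e n) / ((e n).factorial : ℂ) * z ^ e n)
      (∑' k, c k * F (x k * z)) := by
  -- Absolute convergence over pairs justifies the interchange; `G ‖x k * z‖` is the sum of the
  -- absolute values in row `k`.
  have hsum : Summable fun p : ι × ℕ => c p.1 * ((x p.1 * z) ^ e p.2 / ((e p.2).factorial : ℂ)) := by
    refine Summable.of_norm ?_
    have hn : ∀ p : ι × ℕ, ‖c p.1 * ((x p.1 * z) ^ e p.2 / ((e p.2).factorial : ℂ))‖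
        = ‖c p.1‖ * (‖x p.1 * z‖ ^ e p.2 / ((e p.2).factorial : ℝ)) := fun p => by
      rw [norm_mul (c p.1), norm_div, norm_pow, Complex.norm_natCast]
    simp only [hn]
    have hnn : 0 ≤ fun p : ι × ℕ => ‖c p.1‖ * (‖x p.1 * z‖ ^ e p.2 / ((e p.2).factorial : ℝ)) :=
      fun p => mul_nonneg (norm_nonneg _) (div_nonneg (pow_nonneg (norm_nonneg _) _)
        (Nat.cast_nonneg _))
    rw [summable_prod_of_nonneg hnn]
    have hk : ∀ k, HasSum (fun n => ‖c k‖ * (‖x k * z‖ ^ e n / ((e n).factorial : ℝ)))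
      (‖c k‖ * G ‖x k * z‖) := fun k => (hG ‖x k * z‖).mul_left ‖c k‖
    refine ⟨fun k => (hk k).summable, hs.congr fun k => ?_⟩
    exact (hk k).tsum_eq.symm
  have h1 : ∑' p : ι × ℕ, c p.1 * ((x p.1 * z) ^ e p.2 / ((e p.2).factorial : ℂ))
      = ∑' k, c k * F (x k * z) := by
    rw [hsum.tsum_prod]
    exact tsum_congr fun k => ((hF (x k * z)).mul_left (c k)).tsum_eq
  rw [← h1]
  have h2 := hsum.prod_symm.hasSum.prod_fiberwise fun n => (hsum.prod_symm.prod_factor n).hasSum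
  have h3 : ∑' p : ℕ × ι, c p.swap.1 * ((x p.swap.1 * z) ^ e p.swap.2 / ((e p.swap.2).factorial : ℂ))
      = ∑' p : ι × ℕ, c p.1 * ((x p.1 * z) ^ e p.2 / ((e p.2).factorial : ℂ)) :=
    (Equiv.prodComm ℕ ι).tsum_eq
      (fun p : ι × ℕ => c p.1 * ((x p.1 * z) ^ e p.2 / ((e p.2).factorial : ℂ)))
  rw [h3] at h2
  refine h2.congr_fun fun n => ?_
  rw [div_mul_eq_mul_div, ← tsum_mul_right, ← tsum_div_const]
  refine tsum_congr fun k => ?_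
  simp only [Prod.swap]
  rw [mul_pow]
  ring

open Complex

/-- The theta function with characteristics whose Taylor coefficients at `z = 0` are the series
`thetaU`. -/
noncomputable def jacobiU (z τ : ℂ) : ℂ :=
  cexp (Real.pi * I * z + Real.pi * I * τ / 4) * jacobiTheta₂ (z + 1 / 2 + τ / 2) τ

/-- The theta function with characteristics whose even Taylor coefficients at `z = 0` are the series
`thetaV`. -/
noncomputable def jacobiV (z τ : ℂ) : ℂ :=
  cexp (Real.pi * I * z + Real.pi * I * τ / 12) * jacobiTheta₂ (3 * z + 1 / 2 + τ / 2) (3 * τ)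

/-! ### Theta functions under inversion -/

theorem jacobiTheta₂_S_eq (z : ℂ) {τ : ℂ} (hτ : τ ≠ 0) :
    jacobiTheta₂ (z / τ) (-1 / τ)
      = (-I * τ) ^ (1 / 2 : ℂ) * cexp (Real.pi * I * z ^ 2 / τ) * jacobiTheta₂ z τ := by
  have h := jacobiTheta₂_functional_equation z τ
  have h0 : (-I * τ) ^ (1 / 2 : ℂ) ≠ 0 := by
    rw [Ne, cpow_eq_zero_iff]
    simp [hτ]
  have h1 : cexp (Real.pi * I * z ^ 2 / τ) * cexp (-Real.pi * I * z ^ 2 / τ) = 1 := by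
    rw [← Complex.exp_add, ← Complex.exp_zero]; congr 1; ring
  rw [h, ← mul_assoc, ← mul_assoc, mul_assoc _ _ (cexp (-Real.pi * I * z ^ 2 / τ))]
  have h2 : (-I * τ) ^ (1 / 2 : ℂ) * cexp (Real.pi * I * z ^ 2 / τ) *
      (1 / (-I * τ) ^ (1 / 2 : ℂ) * cexp (-Real.pi * I * z ^ 2 / τ)) = 1 := by
    rw [mul_mul_mul_comm, mul_one_div_cancel h0, one_mul, h1]
  rw [h2, one_mul]

theorem jacobiU_S (z : ℂ) {τ : ℂ} (hτ : τ ≠ 0) :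
    jacobiU (z / τ) (-1 / τ)
      = -I * (-I * τ) ^ (1 / 2 : ℂ) * cexp (Real.pi * I * z ^ 2 / τ) * jacobiU z τ := by
  -- Inversion turns the shift `τ / 2` into `+1 / (2 τ)` where `-1 / (2 τ)` is needed. The two
  -- differ by the period `-1 / τ`, and quasi-periodicity bridges the gap.
  have h1 := jacobiTheta₂_add_left' (z / τ + 1 / 2 + 1 / τ / 2) (-1 / τ)
  have h2 := jacobiTheta₂_S_eq (z + 1 / 2 + τ / 2) hτ
  rw [show z / τ + 1 / 2 + 1 / τ / 2 + -1 / τ = z / τ + 1 / 2 + -1 / τ / 2 by ring] at h1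
  rw [show (z + 1 / 2 + τ / 2) / τ = z / τ + 1 / 2 + 1 / τ / 2 by field_simp; ring] at h2
  rw [jacobiU, jacobiU, h1, h2]
  have hI : -I = cexp (-(Real.pi / 2 * I)) := by
    rw [Complex.exp_neg, Complex.exp_pi_div_two_mul_I, inv_I]
  have hexp : cexp (Real.pi * I * (z / τ) + Real.pi * I * (-1 / τ) / 4) *
      (cexp (-Real.pi * I * (-1 / τ + 2 * (z / τ + 1 / 2 + 1 / τ / 2))) *
        cexp (Real.pi * I * (z + 1 / 2 + τ / 2) ^ 2 / τ))
      = cexp (-(Real.pi / 2 * I)) * cexp (Real.pi * I * z ^ 2 / τ) *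
        cexp (Real.pi * I * z + Real.pi * I * τ / 4) := by
    simp only [← Complex.exp_add]
    congr 1
    field_simp
    ring
  rw [← hI] at hexp
  linear_combination (-I * τ) ^ (1 / 2 : ℂ) * jacobiTheta₂ (z + 1 / 2 + τ / 2) τ * hexp

/-- The theta function that corresponds to `jacobiV` under `τ ↦ -1 / τ`. -/
noncomputable def jacobiVDual (z τ : ℂ) : ℂ :=
  cexp (-(Real.pi * I * z) + Real.pi * I * τ / 12 - Real.pi * I / 6) *
    jacobiTheta₂ (z + 1 / 6 - τ / 6) (τ / 3)

theorem jacobiVDual_S (z : ℂ) {τ : ℂ} (hτ : τ ≠ 0) :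
    jacobiVDual (z / τ) (-1 / τ)
      = (-I * (3 * τ)) ^ (1 / 2 : ℂ) * cexp (3 * Real.pi * I * z ^ 2 / τ) * jacobiV z τ := by
  have h2 := jacobiTheta₂_S_eq (3 * z + 1 / 2 + τ / 2) (mul_ne_zero three_ne_zero hτ)
  rw [show (3 * z + 1 / 2 + τ / 2) / (3 * τ) = z / τ + 1 / 6 - -1 / τ / 6 by field_simp; ring,
    show -1 / (3 * τ) = -1 / τ / 3 by field_simp] at h2
  have hexp : cexp (-(Real.pi * I * (z / τ)) + Real.pi * I * (-1 / τ) / 12 - Real.pi * I / 6) *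
      cexp (Real.pi * I * (3 * z + 1 / 2 + τ / 2) ^ 2 / (3 * τ))
      = cexp (3 * Real.pi * I * z ^ 2 / τ) *
        cexp (Real.pi * I * z + Real.pi * I * τ / 12) := by
    simp only [← Complex.exp_add]
    congr 1
    field_simp
    ring
  rw [jacobiVDual, jacobiV, h2]
  linear_combination (-I * (3 * τ)) ^ (1 / 2 : ℂ) *
    jacobiTheta₂ (3 * z + 1 / 2 + τ / 2) (3 * τ) * hexp

/-- The exponential prefactor completes the square in the exponent of `τ`, and the shift `1 / 2`
produces the sign. -/
theorem hasSum_jacobiU (z : ℂ) {τ : ℂ} (hτ : 0 < τ.im) :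
    HasSum (fun k : ℤ => (-1 : ℂ) ^ k * cexp (Real.pi * I * (2 * k + 1) * z) *
      cexp (Real.pi * I * τ * (2 * k + 1) ^ 2 / 4)) (jacobiU z τ) := by
  refine ((hasSum_jacobiTheta₂_term (z + 1 / 2 + τ / 2) hτ).mul_left _).congr_fun fun k => ?_
  rw [jacobiTheta₂_term, ← Complex.exp_pi_mul_I, ← Complex.exp_int_mul, ← Complex.exp_add,
    ← Complex.exp_add, ← Complex.exp_add]
  congr 1
  ring

theorem hasSum_jacobiV (z : ℂ) {τ : ℂ} (hτ : 0 < τ.im) :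
    HasSum (fun k : ℤ => (-1 : ℂ) ^ k * cexp (Real.pi * I * (6 * k + 1) * z) *
      cexp (Real.pi * I * τ * (6 * k + 1) ^ 2 / 12)) (jacobiV z τ) := by
  have hτ' : 0 < (3 * τ).im := by simpa using hτ
  refine ((hasSum_jacobiTheta₂_term (3 * z + 1 / 2 + τ / 2) hτ').mul_left _).congr_fun fun k => ?_
  rw [jacobiTheta₂_term, ← Complex.exp_pi_mul_I, ← Complex.exp_int_mul, ← Complex.exp_add,
    ← Complex.exp_add, ← Complex.exp_add]
  congr 1
  ring

theorem hasSum_jacobiVDual (z : ℂ) {τ : ℂ} (hτ : 0 < τ.im) :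
    HasSum (fun m : ℤ => cexp (Real.pi * I * (2 * m - 1) * z + Real.pi * I * τ * (2 * m - 1) ^ 2 / 12)
      * cexp (Real.pi * (2 * m - 1) / 6 * I)) (jacobiVDual z τ) := by
  have hτ' : 0 < (τ / 3).im := by
    have : (τ / 3).im = τ.im / 3 := by simp
    rw [this]; positivity
  refine ((hasSum_jacobiTheta₂_term (z + 1 / 6 - τ / 6) hτ').mul_left _).congr_fun fun k => ?_
  rw [jacobiTheta₂_term, ← Complex.exp_add, ← Complex.exp_add]
  congr 1
  ring

theorem hasSum_int_mod_three {f : ℤ → ℂ} {s s₀ s₁ : ℂ} (h : HasSum f s)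
    (h0 : HasSum (fun k : ℤ => f (3 * k)) s₀) (h1 : HasSum (fun k : ℤ => f (3 * k + 1)) s₁)
    (h2 : ∀ k : ℤ, f (3 * k + 2) = 0) : s = s₀ + s₁ := by
  have h3 := ((Int.divModEquiv 3).symm.hasSum_iff.mpr h).prod_fiberwise fun k => hasSum_fintype _
  refine h3.unique ((h0.add h1).congr_fun fun k => ?_)
  have e0 : k * 3 = 3 * k := mul_comm _ _
  simp [Fin.sum_univ_three, Int.divModEquiv, e0, h2]

theorem Complex.cos_add_int_mul_pi (x : ℂ) (n : ℤ) :
    Complex.cos (x + n * Real.pi) = (-1) ^ n * Complex.cos x := by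
  rw [Complex.cos_antiperiodic.add_int_mul_eq, Int.cast_negOnePow]

/-- Reflecting `m ↦ 1 - m` in the series at `-z` pairs the phases into `2 cos (π (2 m - 1) / 6)`.
This is zero for `m ≡ 2` modulo 3 and `± √3` otherwise. The classes `m = 3 k` and `m = 3 k + 1`,
where `2 m - 1 = 6 k ∓ 1`, give the series of `jacobiV` at `-z` and at `z`. -/
theorem jacobiVDual_add_neg (z : ℂ) {τ : ℂ} (hτ : 0 < τ.im) :
    jacobiVDual z τ + jacobiVDual (-z) τ
      = (Real.sqrt 3 : ℂ) * (jacobiV z τ + jacobiV (-z) τ) := by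
  have hB := (hasSum_jacobiVDual z hτ).add
    (((Equiv.subLeft (1 : ℤ)).hasSum_iff).mpr (hasSum_jacobiVDual (-z) hτ))
  have hE : HasSum (fun m : ℤ =>
      cexp (Real.pi * I * (2 * m - 1) * z + Real.pi * I * τ * (2 * m - 1) ^ 2 / 12)
        * (2 * Complex.cos (Real.pi * (2 * m - 1) / 6)))
      (jacobiVDual z τ + jacobiVDual (-z) τ) := by
    refine hB.congr_fun fun m => ?_
    rw [Complex.two_cos, mul_add]
    congr 1
    simp only [Function.comp_apply, Equiv.subLeft_apply]
    rw [← Complex.exp_add, ← Complex.exp_add]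
    congr 1
    push_cast
    ring
  have hcos : Complex.cos (Real.pi / 6) = Real.sqrt 3 / 2 := by
    have := Real.cos_pi_div_six
    exact_mod_cast congrArg Complex.ofReal this
  have hV := (hasSum_jacobiV z hτ).mul_left (Real.sqrt 3 : ℂ)
  have hV' := (((Equiv.neg ℤ).hasSum_iff).mpr (hasSum_jacobiV (-z) hτ)).mul_left (Real.sqrt 3 : ℂ)
  rw [mul_add, add_comm (_ * jacobiV z τ)]
  refine hasSum_int_mod_three hE (hV'.congr_fun fun k => ?_) (hV.congr_fun fun k => ?_) fun k => ?_
  · have h : Complex.cos (Real.pi * (2 * ((3 * k : ℤ) : ℂ) - 1) / 6)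
        = (-1) ^ k * (Real.sqrt 3 / 2) := by
      rw [← hcos, ← Complex.cos_neg (Real.pi / 6), ← Complex.cos_add_int_mul_pi]
      congr 1; push_cast; ring
    rw [h]
    simp only [Function.comp_apply, Equiv.neg_apply, zpow_neg, Int.cast_neg]
    have h' : ((-1 : ℂ) ^ k)⁻¹ = (-1) ^ k := by rw [← inv_zpow]; norm_num
    rw [h', mul_assoc ((-1 : ℂ) ^ k) _ (cexp _), ← Complex.exp_add]
    have e : ((Real.pi : ℂ) * I * (2 * ((3 * k : ℤ) : ℂ) - 1) * z
        + Real.pi * I * τ * (2 * ((3 * k : ℤ) : ℂ) - 1) ^ 2 / 12)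
        = Real.pi * I * (6 * -k + 1) * -z + Real.pi * I * τ * (6 * -k + 1) ^ 2 / 12 := by
      push_cast; ring
    rw [e]
    ring
  · have h : Complex.cos (Real.pi * (2 * ((3 * k + 1 : ℤ) : ℂ) - 1) / 6)
        = (-1) ^ k * (Real.sqrt 3 / 2) := by
      rw [← hcos, ← Complex.cos_add_int_mul_pi]
      congr 1; push_cast; ring
    rw [h, mul_assoc ((-1 : ℂ) ^ k) _ (cexp _), ← Complex.exp_add]
    have e : ((Real.pi : ℂ) * I * (2 * ((3 * k + 1 : ℤ) : ℂ) - 1) * z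
        + Real.pi * I * τ * (2 * ((3 * k + 1 : ℤ) : ℂ) - 1) ^ 2 / 12)
        = Real.pi * I * (6 * k + 1) * z + Real.pi * I * τ * (6 * k + 1) ^ 2 / 12 := by
      push_cast; ring
    rw [e]
    ring
  · have h : Complex.cos (Real.pi * (2 * ((3 * k + 2 : ℤ) : ℂ) - 1) / 6) = 0 := by
      rw [Complex.cos_eq_zero_iff]
      exact ⟨k, by push_cast; ring⟩
    rw [h, mul_zero, mul_zero]

theorem jacobiV_add_neg_S (z : ℂ) {τ : ℂ} (hτ : 0 < τ.im) :
    jacobiV (z / τ) (-1 / τ) + jacobiV (-(z / τ)) (-1 / τ)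
      = (-I * (3 * τ)) ^ (1 / 2 : ℂ) / (Real.sqrt 3 : ℂ) * cexp (3 * Real.pi * I * z ^ 2 / τ)
        * (jacobiV z τ + jacobiV (-z) τ) := by
  have hτ0 : τ ≠ 0 := by rintro rfl; simp at hτ
  have hS : 0 < (-1 / τ).im := by
    rw [neg_div, neg_im, one_div, inv_im, neg_div, neg_neg]
    exact div_pos hτ (normSq_pos.mpr hτ0)
  have hs : (Real.sqrt 3 : ℂ) ≠ 0 := by
    exact_mod_cast (Real.sqrt_pos.mpr three_pos).ne'
  have h := jacobiVDual_add_neg (z / τ) hS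
  rw [← neg_div, jacobiVDual_S z hτ0, jacobiVDual_S (-z) hτ0, neg_sq, ← mul_add, neg_div τ z] at h
  rw [div_mul_eq_mul_div, div_mul_eq_mul_div, eq_div_iff hs, h]
  exact mul_comm _ _

/-! ### Taylor expansions of the theta functions in `z` -/

theorem exp_eq_nome_pow (τ : UpperHalfPlane) (n : ℕ) :
    cexp (2 * Real.pi * I * (τ : ℂ) * n) = nome τ ^ n := by
  rw [nome, ← Complex.exp_nat_mul]; congr 1; ring

theorem hasSum_taylor_jacobiU (z : ℂ) (τ : UpperHalfPlane) :
    HasSum (fun n : ℕ => 2 * (Real.pi * I) ^ (2 * n + 1) / ((2 * n + 1).factorial : ℂ) *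
        thetaU (2 * n + 1) (nome τ) * z ^ (2 * n + 1))
      (cexp (-(Real.pi * I * τ / 4)) * jacobiU z τ) := by
  set c : ℕ → ℂ := fun k => 2 * ((-1) ^ k * nome τ ^ (k * (k + 1) / 2)) with hc
  set x : ℕ → ℂ := fun k => Real.pi * I * (2 * k + 1) with hx
  have hexp : ∀ k : ℕ, cexp (-(Real.pi * I * τ / 4)) * cexp (Real.pi * I * τ * (2 * k + 1) ^ 2 / 4)
      = nome τ ^ (k * (k + 1) / 2) := by
    intro k
    have h2 : ((k * (k + 1) / 2 : ℕ) : ℂ) = k * (k + 1) / 2 := by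
      rw [Nat.cast_div (Nat.even_mul_succ_self k).two_dvd two_ne_zero]; push_cast; rfl
    rw [← exp_eq_nome_pow, ← Complex.exp_add, h2]
    congr 1
    ring
  have hsum : HasSum (fun k => c k * Complex.sinh (x k * z))
      (cexp (-(Real.pi * I * τ / 4)) * jacobiU z τ) := by
    -- The indices `k` and `-k - 1` carry opposite signs and opposite values of `2 k + 1`, so each
    -- pair yields a hyperbolic sine.
    refine ((hasSum_jacobiU z τ.im_pos).nat_add_neg_add_one.mul_left _).congr_fun fun k => ?_
    have e1 : ((-(k + 1 : ℤ) : ℤ) : ℂ) = -((k : ℂ) + 1) := by push_cast; ring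
    have e2 : (-1 : ℂ) ^ (-(k + 1 : ℤ)) = -(-1) ^ k := by
      rw [zpow_neg, ← inv_zpow]
      norm_cast
      norm_num [pow_succ]
    rw [e1, e2, zpow_natCast, Int.cast_natCast]
    have e3 : (2 * -((k : ℂ) + 1) + 1) = -(2 * k + 1) := by ring
    simp only [hc, hx]
    rw [e3, neg_sq, ← hexp k, Complex.sinh]
    rw [show (Real.pi : ℂ) * I * -(2 * k + 1) * z = -(Real.pi * I * (2 * k + 1) * z) by ring]
    ring
  have hs : Summable fun k => ‖c k‖ * Real.sinh ‖x k * z‖ := by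
    -- At `-i ‖z‖` the exponentials become `exp (π (2 k + 1) ‖z‖)`, which dominates the hyperbolic
    -- sine.
    have h' := (((hasSum_jacobiU (-I * ‖z‖) τ.im_pos).summable.comp_injective
      Nat.cast_injective).mul_left (2 * cexp (-(Real.pi * I * τ / 4)))).norm
    refine Summable.of_nonneg_of_le (fun k => mul_nonneg (norm_nonneg _)
      (Real.sinh_nonneg_iff.mpr (norm_nonneg _))) (fun k => ?_) h'
    have e : 2 * cexp (-(Real.pi * I * τ / 4)) * ((-1 : ℂ) ^ (k : ℤ) *
        cexp (Real.pi * I * (2 * ((k : ℤ) : ℂ) + 1) * (-I * ‖z‖)) *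
        cexp (Real.pi * I * τ * (2 * ((k : ℤ) : ℂ) + 1) ^ 2 / 4))
        = c k * cexp (((Real.pi * (2 * k + 1) * ‖z‖ : ℝ) : ℂ)) := by
      simp only [hc, Int.cast_natCast, zpow_natCast, ← hexp k]
      have : (Real.pi : ℂ) * I * (2 * k + 1) * (-I * ‖z‖)
          = ((Real.pi * (2 * k + 1) * ‖z‖ : ℝ) : ℂ) := by
        push_cast
        linear_combination -(Real.pi : ℂ) * (2 * k + 1) * ‖z‖ * I_mul_I
      rw [this]
      ring
    simp only [Function.comp_apply]
    rw [e, norm_mul (c k), ← Complex.ofReal_exp, Complex.norm_real, Real.norm_of_nonneg (Real.exp_pos _).le]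
    have hn : ‖x k * z‖ = Real.pi * (2 * k + 1) * ‖z‖ := by
      simp only [hx, norm_mul, Complex.norm_I, mul_one, Complex.norm_real,
        Real.norm_of_nonneg Real.pi_pos.le]
      have : ‖(2 * k + 1 : ℂ)‖ = 2 * k + 1 := by
        rw [show (2 * k + 1 : ℂ) = ((2 * k + 1 : ℕ) : ℂ) by push_cast; ring, Complex.norm_natCast]
        push_cast; ring
      rw [this]
    rw [hn]
    gcongr
    rw [Real.sinh_eq]
    have h1 := Real.exp_pos (Real.pi * (2 * k + 1) * ‖z‖)
    have h2 := Real.exp_pos (-(Real.pi * (2 * k + 1) * ‖z‖))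
    linarith
  have key := hasSum_tsum_comm (e := fun n => 2 * n + 1) Complex.hasSum_sinh Real.hasSum_sinh hs
  rw [hsum.tsum_eq] at key
  refine key.congr_fun fun n => ?_
  congr 1
  rw [div_mul_eq_mul_div]
  congr 1
  rw [thetaU, ← tsum_mul_left]
  refine tsum_congr fun k => ?_
  simp only [hc, hx]
  rw [mul_pow (Real.pi * I : ℂ)]
  ring

theorem hasSum_taylor_jacobiV (z : ℂ) (τ : UpperHalfPlane) :
    HasSum (fun n : ℕ => 2 * (Real.pi * I) ^ (2 * n) / ((2 * n).factorial : ℂ) *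
        thetaV (2 * n) (nome τ) * z ^ (2 * n))
      (cexp (-(Real.pi * I * τ / 12)) * (jacobiV z τ + jacobiV (-z) τ)) := by
  set c : ℤ → ℂ := fun k => 2 * ((-1) ^ k.natAbs * nome τ ^ (k * (3 * k + 1) / 2).toNat) with hc
  set x : ℤ → ℂ := fun k => Real.pi * I * (6 * k + 1) with hx
  have hexp : ∀ k : ℤ,
      cexp (-(Real.pi * I * τ / 12)) * cexp (Real.pi * I * τ * (6 * k + 1) ^ 2 / 12)
      = nome τ ^ (k * (3 * k + 1) / 2).toNat := by
    intro k
    have hdvd : (2 : ℤ) ∣ k * (3 * k + 1) := by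
      rcases Int.even_or_odd' k with ⟨m, rfl | rfl⟩
      · exact ⟨m * (3 * (2 * m) + 1), by ring⟩
      · exact ⟨(2 * m + 1) * (3 * m + 2), by ring⟩
    have hnn : 0 ≤ k * (3 * k + 1) / 2 := by
      refine Int.ediv_nonneg ?_ zero_le_two
      rcases le_or_gt 0 k with h | h <;> nlinarith
    have h2 : (((k * (3 * k + 1) / 2).toNat : ℕ) : ℂ) = k * (3 * k + 1) / 2 := by
      rw [← Int.cast_natCast (R := ℂ), Int.toNat_of_nonneg hnn, Int.cast_div hdvd (by norm_num)]
      push_cast; rfl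
    rw [← exp_eq_nome_pow, ← Complex.exp_add, h2]
    congr 1
    ring
  have hsign : ∀ k : ℤ, (-1 : ℂ) ^ k = (-1) ^ k.natAbs := by
    intro k
    rcases Int.natAbs_eq k with h | h
    · conv_lhs => rw [h, zpow_natCast]
    · conv_lhs => rw [h, zpow_neg, zpow_natCast, ← inv_pow]
      norm_num
  have hsum : HasSum (fun k => c k * Complex.cosh (x k * z))
      (cexp (-(Real.pi * I * τ / 12)) * (jacobiV z τ + jacobiV (-z) τ)) := by
    refine (((hasSum_jacobiV z τ.im_pos).add (hasSum_jacobiV (-z) τ.im_pos)).mul_left _).congr_fun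
      fun k => ?_
    simp only [hc, hx]
    rw [hsign, ← hexp k, Complex.cosh, mul_neg]
    ring
  have hs : Summable fun k => ‖c k‖ * Real.cosh ‖x k * z‖ := by
    -- Used at `R = ± ‖z‖`: the average of the two exponentials is the hyperbolic cosine, whatever
    -- the sign of `6 k + 1`.
    have hb : ∀ R : ℝ, Summable fun k : ℤ => ‖c k‖ * Real.exp (Real.pi * (6 * k + 1) * R) := by
      intro R
      have h' := ((hasSum_jacobiV (-I * R) τ.im_pos).summable.mul_left
        (2 * cexp (-(Real.pi * I * τ / 12)))).norm
      refine h'.congr fun k => ?_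
      have e : 2 * cexp (-(Real.pi * I * τ / 12)) * ((-1 : ℂ) ^ k *
          cexp (Real.pi * I * (6 * k + 1) * (-I * R)) *
          cexp (Real.pi * I * τ * (6 * k + 1) ^ 2 / 12))
          = c k * cexp (((Real.pi * (6 * k + 1) * R : ℝ) : ℂ)) := by
        simp only [hc, hsign, ← hexp k]
        have : (Real.pi : ℂ) * I * (6 * k + 1) * (-I * R)
            = ((Real.pi * (6 * k + 1) * R : ℝ) : ℂ) := by
          push_cast
          linear_combination -(Real.pi : ℂ) * (6 * k + 1) * R * I_mul_I
        rw [this]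
        ring
      rw [e, norm_mul (c k), ← Complex.ofReal_exp, Complex.norm_real,
        Real.norm_of_nonneg (Real.exp_pos _).le]
    refine (((hb ‖z‖).add (hb (-‖z‖))).div_const 2).congr fun k => ?_
    have hn : ‖x k * z‖ = |Real.pi * (6 * k + 1) * ‖z‖| := by
      have : x k * z = ((Real.pi * (6 * k + 1) : ℝ) : ℂ) * I * z := by
        simp only [hx]; push_cast; ring
      rw [this, norm_mul, norm_mul, Complex.norm_I, Complex.norm_real, mul_one, abs_mul, abs_norm,
        Real.norm_eq_abs]
    rw [hn, Real.cosh_abs, Real.cosh_eq, mul_neg]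
    ring
  have key := hasSum_tsum_comm (e := fun n => 2 * n) Complex.hasSum_cosh Real.hasSum_cosh hs
  rw [hsum.tsum_eq] at key
  refine key.congr_fun fun n => ?_
  congr 1
  rw [div_mul_eq_mul_div]
  congr 1
  rw [thetaV, ← tsum_mul_left]
  refine tsum_congr fun k => ?_
  simp only [hc, hx]
  rw [mul_pow (Real.pi * I : ℂ)]
  ring

/-! ### Modularity of the completions -/

theorem coe_S_smul (τ : UpperHalfPlane) :
    ((ModularGroup.S • τ : UpperHalfPlane) : ℂ) = -1 / (τ : ℂ) := by
  rw [UpperHalfPlane.modular_S_smul, UpperHalfPlane.coe_mk, inv_neg, neg_div, one_div]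

/-- Since `Im (-1 / τ) = v / (τ * conj τ)`, this amounts to `conj τ + 2 i v = τ`. It is the
compatibility `hc` required by `sum_completion_transform`. -/
theorem inv_im_S_smul (τ : UpperHalfPlane) (κ : ℂ) :
    κ / ((ModularGroup.S • τ).im : ℂ) / (τ : ℂ) ^ 2 + 2 * κ * I / (τ : ℂ) = κ / (τ.im : ℂ) := by
  have hτ := τ.ne_zero
  have hv : (τ.im : ℂ) ≠ 0 := by exact_mod_cast τ.im_ne_zero
  have hc : (starRingEnd ℂ) (τ : ℂ) ≠ 0 := by simpa using hτ
  have him : ((ModularGroup.S • τ).im : ℂ) = τ.im / ((τ : ℂ) * (starRingEnd ℂ) (τ : ℂ)) := by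
    have h : (ModularGroup.S • τ).im = τ.im / normSq (τ : ℂ) := by
      rw [← UpperHalfPlane.coe_im, coe_S_smul, neg_div, neg_im, one_div, inv_im,
        UpperHalfPlane.coe_im, neg_div, neg_neg]
    rw [h, mul_conj]; push_cast; rfl
  have hsub : (τ : ℂ) - (starRingEnd ℂ) (τ : ℂ) = 2 * τ.im * I := by
    rw [sub_conj, UpperHalfPlane.coe_im]; push_cast; ring
  rw [him]
  field_simp
  linear_combination -κ * hsub

/-- The denominator carries the same factor `C` as the generating function, so only the power of `τ`
remains. -/
theorem completion_S_smul {κ : ℂ} {a : ℕ → ℂ → ℂ} {d : ℂ → ℂ} {f : ℂ → UpperHalfPlane → ℂ}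
    {C : ℂ} (hC : C ≠ 0) (τ : UpperHalfPlane)
    (hf : ∀ z ≠ 0, ∀ τ, HasSum (fun n => a n (nome τ) * (z ^ 2) ^ n) (f z τ))
    (hd : d (nome (ModularGroup.S • τ)) = C * d (nome τ))
    (hfS : ∀ z ≠ 0, f (z / τ) (ModularGroup.S • τ)
      = C * cexp (2 * κ * I / τ * z ^ 2) * f z τ) (n : ℕ) :
    completion κ (fun m q => a m q / d q) n (ModularGroup.S • τ)
      = (τ : ℂ) ^ (2 * n) * completion κ (fun m q => a m q / d q) n τ := by
  have h := sum_completion_transform τ.ne_zero (inv_im_S_smul τ κ) (fun z hz => hf z hz τ)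
    (fun z hz => hf z hz (ModularGroup.S • τ)) hfS n
  simp only [completion, ← mul_div_assoc, ← Finset.sum_div]
  rw [h, hd, mul_assoc C, mul_div_mul_left _ _ hC, mul_div_assoc]

/-- The zeroth Taylor coefficient transforms by the automorphy factor. -/
theorem coeff_zero_S_smul {κ : ℂ} {a : ℕ → ℂ → ℂ} {f : ℂ → UpperHalfPlane → ℂ}
    {C : ℂ} (τ : UpperHalfPlane)
    (hf : ∀ z ≠ 0, ∀ τ, HasSum (fun n => a n (nome τ) * (z ^ 2) ^ n) (f z τ))
    (hfS : ∀ z ≠ 0, f (z / τ) (ModularGroup.S • τ)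
      = C * cexp (2 * κ * I / τ * z ^ 2) * f z τ) :
    a 0 (nome (ModularGroup.S • τ)) = C * a 0 (nome τ) := by
  simpa using sum_completion_transform τ.ne_zero (inv_im_S_smul τ κ) (fun z hz => hf z hz τ)
    (fun z hz => hf z hz (ModularGroup.S • τ)) hfS 0

/-! ### The series `U` -/

/-- The Taylor coefficients of `jacobiU`, up to a common factor. -/
noncomputable def coeffU (n : ℕ) (q : ℂ) : ℂ :=
  2 * (Real.pi * I) ^ (2 * n + 1) / ((2 * n + 1).factorial : ℂ) * thetaU (2 * n + 1) q

/-- The even function of `z` with Taylor coefficients `coeffU`. -/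
noncomputable def evenU (z : ℂ) (τ : UpperHalfPlane) : ℂ :=
  cexp (-(Real.pi * I * τ / 4)) * jacobiU z τ / z

/-- The automorphy factor of `thetaU 1` under `τ ↦ -1 / τ`. -/
noncomputable def factorU (τ : UpperHalfPlane) : ℂ :=
  -I * (-I * τ) ^ (1 / 2 : ℂ) * τ *
    cexp (Real.pi * I * τ / 4 - Real.pi * I * (-1 / (τ : ℂ)) / 4)

theorem hasSum_evenU (z : ℂ) (hz : z ≠ 0) (τ : UpperHalfPlane) :
    HasSum (fun n => coeffU n (nome τ) * (z ^ 2) ^ n) (evenU z τ) := by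
  refine ((hasSum_taylor_jacobiU z τ).div_const z).congr_fun fun n => ?_
  rw [coeffU, pow_succ z (2 * n), pow_mul z, ← mul_assoc, mul_div_cancel_right₀ _ hz]

theorem neg_I_mul_cpow_half_sq (z : ℂ) : ((-I * z) ^ (1 / 2 : ℂ)) ^ 2 = -I * z := by
  rw [one_div]
  exact cpow_nat_inv_pow _ two_ne_zero

theorem neg_I_mul_cpow_half_ne_zero {z : ℂ} (hz : z ≠ 0) : (-I * z) ^ (1 / 2 : ℂ) ≠ 0 := by
  intro h
  have := neg_I_mul_cpow_half_sq z
  rw [h] at this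
  simp [hz] at this

theorem factorU_ne_zero (τ : UpperHalfPlane) : factorU τ ≠ 0 :=
  mul_ne_zero (mul_ne_zero (mul_ne_zero (neg_ne_zero.mpr I_ne_zero)
    (neg_I_mul_cpow_half_ne_zero τ.ne_zero)) τ.ne_zero) (Complex.exp_ne_zero _)

theorem evenU_S_smul (τ : UpperHalfPlane) (z : ℂ) (hz : z ≠ 0) :
    evenU (z / τ) (ModularGroup.S • τ)
      = factorU τ * cexp (2 * (Real.pi / 2) * I / τ * z ^ 2) * evenU z τ := by
  have hτ := τ.ne_zero
  have hexp : cexp (-(Real.pi * I * (-1 / (τ : ℂ)) / 4))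
      = cexp (Real.pi * I * τ / 4 - Real.pi * I * (-1 / (τ : ℂ)) / 4) *
        cexp (-(Real.pi * I * τ / 4)) := by
    rw [← Complex.exp_add]; congr 1; ring
  have he : 2 * ((Real.pi : ℂ) / 2) * I / τ * z ^ 2 = Real.pi * I * z ^ 2 / τ := by ring
  rw [evenU, evenU, coe_S_smul, jacobiU_S z hτ, factorU, hexp, he]
  field_simp

theorem thetaU_one_S_smul (τ : UpperHalfPlane) :
    thetaU 1 (nome (ModularGroup.S • τ)) = factorU τ * thetaU 1 (nome τ) := by
  have h := coeff_zero_S_smul τ hasSum_evenU (evenU_S_smul τ)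
  have h0 : (2 : ℂ) * (Real.pi * I) ≠ 0 :=
    mul_ne_zero two_ne_zero (mul_ne_zero (ofReal_ne_zero.mpr Real.pi_ne_zero) I_ne_zero)
  simp only [coeffU, mul_zero, zero_add, pow_one, Nat.factorial_one, Nat.cast_one, div_one] at h
  rw [mul_left_comm (factorU τ)] at h
  exact mul_left_cancel₀ h0 h

/-- The weight is `3 / 2`, so the eighth power has weight 12. It also removes the root of unity, and
the exponentials in `factorU` account for the extra factor `q`. -/
theorem thetaU_one_ne_zero {q : ℂ} (hq : q ∈ Metric.ball (0 : ℂ) 1) : thetaU 1 q ≠ 0 := by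
  refine ne_zero_pow (n := 8) (by norm_num) <| ne_zero_on_ball_of_weight_twelve
    (g := fun q => thetaU 1 q ^ 8) ((differentiableOn_thetaU 1).pow 8)
    (by simp [thetaU_zero_right]) (fun τ => ?_) hq
  have hτ := τ.ne_zero
  have hexp : nome (ModularGroup.S • τ) *
      cexp (Real.pi * I * τ / 4 - Real.pi * I * (-1 / (τ : ℂ)) / 4) ^ 8 = nome τ := by
    rw [nome, nome, coe_S_smul, ← Complex.exp_nat_mul, ← Complex.exp_add]
    congr 1
    push_cast
    ring
  have hpow : (-I * (-I * (τ : ℂ)) ^ (1 / 2 : ℂ) * τ) ^ 8 = (τ : ℂ) ^ 12 := by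
    have h := neg_I_mul_cpow_half_sq (τ : ℂ)
    rw [mul_pow, mul_pow, show 8 = 2 * 4 from rfl, pow_mul (_ ^ (1 / 2 : ℂ)), h, mul_pow,
      pow_mul (-I), neg_sq, I_sq, show (-I) ^ 4 = 1 by rw [neg_pow, I_pow_four]; norm_num]
    ring
  rw [thetaU_one_S_smul, factorU, mul_pow, mul_pow, hpow, ← hexp]
  ring

theorem differentiableOn_coeffU_div (n : ℕ) :
    DifferentiableOn ℂ (fun q => coeffU n q / thetaU 1 q) (Metric.ball 0 1) :=
  ((differentiableOn_thetaU _).const_mul _).div (differentiableOn_thetaU 1)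
    fun _ hq => thetaU_one_ne_zero hq

theorem coeffU_div_eq (n : ℕ) (q : ℂ) : coeffU n q / thetaU 1 q
    = 2 * (Real.pi * I) ^ (2 * n + 1) * ramanujanU n q / ((2 * n + 1).factorial : ℂ) := by
  rw [coeffU, ramanujanU]
  ring

theorem completedU_eq_completion (n : ℕ) :
    completedU n = completion (Real.pi / 2) (fun m q => coeffU m q / thetaU 1 q) n := by
  funext τ
  have hv : (τ.im : ℂ) ≠ 0 := by exact_mod_cast τ.im_ne_zero
  rw [completedU, completion, Finset.mul_sum]
  refine Finset.sum_congr rfl fun j hj => ?_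
  -- Writing `n = j + m` removes truncated subtraction; the sign `(-1) ^ (n + j) = (-1) ^ m` comes
  -- from `I ^ (2 * m)`.
  obtain ⟨m, rfl⟩ := Nat.exists_eq_add_of_le (Nat.lt_succ_iff.mp (Finset.mem_range.mp hj))
  rw [coeffU_div_eq, show j + m - j = m by omega, show 2 * (j + m) - j + 1 = j + (2 * m + 1) by omega,
    show 2 * (j + m) - 2 * j + 1 = 2 * m + 1 by omega, mul_pow (Real.pi : ℂ), pow_succ I, pow_mul I,
    I_sq, show j + m + j = 2 * j + m by ring, pow_add, pow_mul, neg_one_sq, one_pow,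
    pow_add (Real.pi : ℂ), div_pow, div_pow, mul_pow]
  have hj' : (j.factorial : ℂ) ≠ 0 := by exact_mod_cast j.factorial_ne_zero
  have hm' : ((2 * m + 1).factorial : ℂ) ≠ 0 := by exact_mod_cast (2 * m + 1).factorial_ne_zero
  field_simp

/-! ### The series `V` -/

/-- The even Taylor coefficients of `jacobiV`, up to a common factor. -/
noncomputable def coeffV (n : ℕ) (q : ℂ) : ℂ :=
  2 * (Real.pi * I) ^ (2 * n) / ((2 * n).factorial : ℂ) * thetaV (2 * n) q

/-- The even function of `z` with Taylor coefficients `coeffV`. -/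
noncomputable def evenV (z : ℂ) (τ : UpperHalfPlane) : ℂ :=
  cexp (-(Real.pi * I * τ / 12)) * (jacobiV z τ + jacobiV (-z) τ)

/-- The automorphy factor of `thetaV 0` under `τ ↦ -1 / τ`. -/
noncomputable def factorV (τ : UpperHalfPlane) : ℂ :=
  (-I * (3 * τ)) ^ (1 / 2 : ℂ) / (Real.sqrt 3 : ℂ) *
    cexp (Real.pi * I * τ / 12 - Real.pi * I * (-1 / (τ : ℂ)) / 12)

theorem hasSum_evenV (z : ℂ) (τ : UpperHalfPlane) :
    HasSum (fun n => coeffV n (nome τ) * (z ^ 2) ^ n) (evenV z τ) :=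
  (hasSum_taylor_jacobiV z τ).congr_fun fun n => by rw [coeffV, pow_mul z]

theorem factorV_ne_zero (τ : UpperHalfPlane) : factorV τ ≠ 0 :=
  mul_ne_zero (div_ne_zero
    (neg_I_mul_cpow_half_ne_zero (mul_ne_zero three_ne_zero τ.ne_zero))
    (ofReal_ne_zero.mpr (Real.sqrt_pos.mpr three_pos).ne')) (Complex.exp_ne_zero _)

theorem evenV_S_smul (τ : UpperHalfPlane) (z : ℂ) :
    evenV (z / τ) (ModularGroup.S • τ)
      = factorV τ * cexp (2 * (3 * Real.pi / 2) * I / τ * z ^ 2) * evenV z τ := by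
  have hexp : cexp (-(Real.pi * I * (-1 / (τ : ℂ)) / 12))
      = cexp (Real.pi * I * τ / 12 - Real.pi * I * (-1 / (τ : ℂ)) / 12) *
        cexp (-(Real.pi * I * τ / 12)) := by
    rw [← Complex.exp_add]; congr 1; ring
  have he : 2 * (3 * (Real.pi : ℂ) / 2) * I / τ * z ^ 2 = 3 * Real.pi * I * z ^ 2 / τ := by ring
  rw [evenV, evenV, coe_S_smul, jacobiV_add_neg_S z τ.im_pos, factorV, hexp, he]
  ring

theorem thetaV_zero_S_smul (τ : UpperHalfPlane) :
    thetaV 0 (nome (ModularGroup.S • τ)) = factorV τ * thetaV 0 (nome τ) := by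
  have h := coeff_zero_S_smul τ (fun z _ => hasSum_evenV z) (fun z _ => evenV_S_smul τ z)
  simp only [coeffV, mul_zero, pow_zero, Nat.factorial_zero, Nat.cast_one, div_one, mul_one] at h
  rw [mul_left_comm] at h
  exact mul_left_cancel₀ two_ne_zero h

/-- Here the weight is `1 / 2`, hence the exponent 24. -/
theorem thetaV_zero_ne_zero {q : ℂ} (hq : q ∈ Metric.ball (0 : ℂ) 1) : thetaV 0 q ≠ 0 := by
  refine ne_zero_pow (n := 24) (by norm_num) <| ne_zero_on_ball_of_weight_twelve
    (g := fun q => thetaV 0 q ^ 24) ((differentiableOn_thetaV 0).pow 24)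
    (by simp [thetaV_zero_right]) (fun τ => ?_) hq
  have hexp : nome (ModularGroup.S • τ) *
      cexp (Real.pi * I * τ / 12 - Real.pi * I * (-1 / (τ : ℂ)) / 12) ^ 24 = nome τ := by
    rw [nome, nome, coe_S_smul, ← Complex.exp_nat_mul, ← Complex.exp_add]
    congr 1
    push_cast
    ring
  have hpow : ((-I * (3 * (τ : ℂ))) ^ (1 / 2 : ℂ) / (Real.sqrt 3 : ℂ)) ^ 24 = (τ : ℂ) ^ 12 := by
    have h := neg_I_mul_cpow_half_sq (3 * (τ : ℂ))
    have hs : (Real.sqrt 3 : ℂ) ^ 2 = 3 := by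
      exact_mod_cast congrArg ofReal (Real.sq_sqrt (x := 3) (by norm_num))
    rw [show 24 = 2 * 12 from rfl, pow_mul, div_pow, h, hs, show -I * (3 * (τ : ℂ)) / 3 = -I * τ by
      ring, mul_pow, show (-I) ^ 12 = ((-I) ^ 2) ^ 6 by rw [← pow_mul], neg_sq, I_sq]
    norm_num
  rw [thetaV_zero_S_smul, factorV, mul_pow, mul_pow, hpow, ← hexp]
  ring

/-- The factor 2 in the denominator cancels the one introduced by symmetrizing in `z`. -/
theorem differentiableOn_coeffV_div (n : ℕ) :
    DifferentiableOn ℂ (fun q => coeffV n q / (2 * thetaV 0 q)) (Metric.ball 0 1) :=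
  ((differentiableOn_thetaV _).const_mul _).div ((differentiableOn_thetaV 0).const_mul 2)
    fun _ hq => mul_ne_zero two_ne_zero (thetaV_zero_ne_zero hq)

theorem coeffV_div_eq (n : ℕ) (q : ℂ) : coeffV n q / (2 * thetaV 0 q)
    = (Real.pi * I) ^ (2 * n) / ((2 * n).factorial : ℂ) * ramanujanV n q := by
  rw [coeffV, ramanujanV, mul_div_assoc 2, mul_assoc 2, mul_div_mul_left _ _ two_ne_zero,
    mul_div_assoc]

theorem completedV_eq_completion (n : ℕ) :
    completedV n = completion (3 * Real.pi / 2) (fun m q => coeffV m q / (2 * thetaV 0 q)) n := by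
  funext τ
  have hv : (τ.im : ℂ) ≠ 0 := by exact_mod_cast τ.im_ne_zero
  rw [completedV, completion]
  refine Finset.sum_congr rfl fun j hj => ?_
  obtain ⟨m, rfl⟩ := Nat.exists_eq_add_of_le (Nat.lt_succ_iff.mp (Finset.mem_range.mp hj))
  rw [coeffV_div_eq, show j + m - j = m by omega, show 2 * (j + m) - j = j + 2 * m by omega,
    show 2 * (j + m) - 2 * j = 2 * m by omega, mul_pow (Real.pi : ℂ), pow_mul I,
    I_sq, show j + m + j = 2 * j + m by ring, pow_add, pow_mul, neg_one_sq, one_pow,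
    pow_add (Real.pi : ℂ), div_pow, div_pow, mul_pow, mul_pow 3]
  have hj' : (j.factorial : ℂ) ≠ 0 := by exact_mod_cast j.factorial_ne_zero
  have hm' : ((2 * m).factorial : ℂ) ≠ 0 := by exact_mod_cast (2 * m).factorial_ne_zero
  field_simp

/-! ### Assembly of the theorem -/

theorem completedU_zero (τ : UpperHalfPlane) : completedU 0 τ = 2 * Real.pi * I := by
  have h := thetaU_one_ne_zero (nome_mem_ball τ)
  simp [completedU, ramanujanU, h]
  ring

theorem completedV_zero (τ : UpperHalfPlane) : completedV 0 τ = 1 := by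
  have h := thetaV_zero_ne_zero (nome_mem_ball τ)
  simp [completedV, ramanujanV, h]

theorem isAlmostHolomorphicModularForm_completedU (n : ℕ) :
    IsAlmostHolomorphicModularForm (2 * (n : ℤ)) n (completedU n) := by
  have hpi : (Real.pi : ℂ) ≠ 0 := ofReal_ne_zero.mpr Real.pi_ne_zero
  rw [completedU_eq_completion]
  refine isAlmostHolomorphicModularForm_completion (div_ne_zero hpi two_ne_zero)
    differentiableOn_coeffU_div ⟨UpperHalfPlane.I, ?_⟩ n fun τ =>
    completion_S_smul (factorU_ne_zero τ) τ hasSum_evenU (thetaU_one_S_smul τ) (evenU_S_smul τ) n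
  have h := thetaU_one_ne_zero (nome_mem_ball UpperHalfPlane.I)
  simp [coeffU, h]

theorem isAlmostHolomorphicModularForm_completedV (n : ℕ) :
    IsAlmostHolomorphicModularForm (2 * (n : ℤ)) n (completedV n) := by
  have hpi : (Real.pi : ℂ) ≠ 0 := ofReal_ne_zero.mpr Real.pi_ne_zero
  rw [completedV_eq_completion]
  refine isAlmostHolomorphicModularForm_completion
    (div_ne_zero (mul_ne_zero three_ne_zero hpi) two_ne_zero)
    differentiableOn_coeffV_div ⟨UpperHalfPlane.I, ?_⟩ n fun τ =>
    completion_S_smul (d := fun q => 2 * thetaV 0 q) (factorV_ne_zero τ) τ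
      (fun z _ => hasSum_evenV z) (by rw [thetaV_zero_S_smul, mul_left_comm])
      (fun z _ => evenV_S_smul τ z) n
  have h := thetaV_zero_ne_zero (nome_mem_ball UpperHalfPlane.I)
  simp [coeffV, h]

theorem theorem1p4 :
    -- almost holomorphic modular forms of weight `2n` and depth exactly `n`
    (∀ n : ℕ, IsAlmostHolomorphicModularForm (2 * (n : ℤ)) n (completedU n)
      ∧ IsAlmostHolomorphicModularForm (2 * (n : ℤ)) n (completedV n))
    -- initial values and the action of the lowering operator
    ∧ (∀ τ : UpperHalfPlane, completedU 0 τ = 2 * Real.pi * Complex.I ∧ completedV 0 τ = 1)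
    ∧ (∀ n : ℕ, RealDifferentiable (completedU n) ∧ RealDifferentiable (completedV n))
    ∧ (∀ n : ℕ, 1 ≤ n → ∀ τ : UpperHalfPlane,
        lowering (completedU n) τ = -((Real.pi : ℂ) / 2) * completedU (n - 1) τ
        ∧ lowering (completedV n) τ = -(3 * (Real.pi : ℂ) / 2) * completedV (n - 1) τ)
    -- holomorphic parts, also as the limits for `conj τ → -i∞`
    ∧ (∀ n : ℕ,
        HasHolomorphicPart (completedU n) (fun τ =>
          2 * ((Real.pi : ℂ) * Complex.I) ^ (2 * n + 1) * ramanujanU n (nome τ)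
            / ((2 * n + 1).factorial : ℂ))
        ∧ HasHolomorphicPart (completedV n) (fun τ =>
          ((Real.pi : ℂ) * Complex.I) ^ (2 * n) / ((2 * n).factorial : ℂ)
            * ramanujanV n (nome τ))
        ∧ HasConjLimit (completedU n) (fun τ =>
          2 * ((Real.pi : ℂ) * Complex.I) ^ (2 * n + 1) * ramanujanU n (nome τ)
            / ((2 * n + 1).factorial : ℂ))
        ∧ HasConjLimit (completedV n) (fun τ =>
          ((Real.pi : ℂ) * Complex.I) ^ (2 * n) / ((2 * n).factorial : ℂ)
            * ramanujanV n (nome τ))) := by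
  refine ⟨fun n => ⟨isAlmostHolomorphicModularForm_completedU n,
    isAlmostHolomorphicModularForm_completedV n⟩,
    fun τ => ⟨completedU_zero τ, completedV_zero τ⟩, fun n => ?_, fun n hn τ => ?_, fun n => ?_⟩
  · rw [completedU_eq_completion, completedV_eq_completion]
    exact ⟨realDifferentiable_completion differentiableOn_coeffU_div n,
      realDifferentiable_completion differentiableOn_coeffV_div n⟩
  · obtain ⟨m, rfl⟩ := Nat.exists_eq_add_of_le' hn
    simp only [Nat.add_sub_cancel, completedU_eq_completion, completedV_eq_completion]
    exact ⟨lowering_completion differentiableOn_coeffU_div m τ,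
      lowering_completion differentiableOn_coeffV_div m τ⟩
  · simp only [completedU_eq_completion, completedV_eq_completion, ← coeffU_div_eq,
      ← coeffV_div_eq]
    exact ⟨hasHolomorphicPart_completion differentiableOn_coeffU_div n,
      hasHolomorphicPart_completion differentiableOn_coeffV_div n,
      hasConjLimit_completion differentiableOn_coeffU_div n,
      hasConjLimit_completion differentiableOn_coeffV_div n⟩
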